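/- Let $L>0$, $0<\alpha_1\le\alpha_2$, let $b\neq 0$ be a real constant, let $f\in L^2(0,L)$, and let $A^\varepsilon$ be measurable on $\Omega=(0,L)$ with $\alpha_1\le A^\varepsilon(x)\le\alpha_2$ for a.e. $x\in\Omega$. Put $$a^\varepsilon(u,v)=\int_0^L A^\varepsilon u'v'+b\,u'\,v,\qquad F(v)=\int_0^L f v ,\qquad |v|_{H^1(\Omega)}=\|v'\|_{L^2(\Omega)},$$ and let $u^\varepsilon\in H^1_0(\Omega)$ be the weak solution of $-(A^\varepsilon (u^\varepsilon)')'+b\,(u^\varepsilon)'=f$ in $\Omega$, $u^\varepsilon(0)=u^\varepsilon(L)=0$, i.e. $a^\varepsilon(u^\varepsilon,v)=F(v)$ for all $v\in H^1_0(\Omega)$. Let $0=x_0<x_1<\dots<x_n=L$ be a mesh with elements $K_k=(x_k,x_{k+1})$ ($0\le k<n$) and mesh size $H=\max_k (x_{k+1}-x_k)$, and let $\phi^0_i$, $1\le i\le n-1$, be the continuous piecewise affine functions with $\phi^0_i(x_j)=\delta_{ij}$. Let $\psi^\varepsilon_i$ be the exact multiscale basis functions: on each element $K$, $\psi_i^\varepsilon\in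 H^1(K)$ is the weak solution of $-(A^\varepsilon(\psi_i^\varepsilon)')'=0$ in $K$ with $\psi^\varepsilon_i=\phi^0_i$ on $\partial K$. Let $V_H^\varepsilon=\mathrm{Span}\{\psi^\varepsilon_i:\ 1\le i\le n-1\}$. With $\tau_K=\dfrac{H}{2|b|}$ for every element $K$, let $u^\varepsilon_H\in V^\varepsilon_H$ be the solution of the SUPG-stabilized method: for all $v\in V^\varepsilon_H$, $$a^\varepsilon(u^\varepsilon_H,v)+\sum_{K}\int_K\tau_K\big(-(A^\varepsilon (u^\varepsilon_H)')'+b\,(u^\varepsilon_H)'\big)\,b\,v' = F(v)+\sum_K\int_K \tau_K f\, b\, v',$$ where $(A^\varepsilon (u^\varepsilon_H)')'$ is the weak derivative inside $K$. Assume $\dfrac{|b|L}{\alpha_2}\ge 1$ and $\dfrac{|b|H}{2\alpha_1}\ge 1$. Then $$|u^\varepsilon-u^\varepsilon_H|_{H^1(\Omega)}\le C\,H\left(1+\sqrt{\frac{\alpha_2^2}{\alpha_1^2}+\frac{|b|H}{\alpha_1}}\right)\left(1+\frac{\sqrt{2\alpha_2L|b|}}{\alpha_1}\right)\frac{\|f\|_{L^2(\Omega)}}{\alpha_1},$$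 where $C>0$ is a universal constant: it depends on none of $L,\alpha_1,\alpha_2,b,A^\varepsilon,f$ or the mesh. -/

import Mathlib

open MeasureTheory Set
open scoped ContDiff

noncomputable section

namespace StabMsFEM

/-! ### Sobolev spaces on a bounded interval -/

/-- `g` is the weak derivative of `u` on the open interval `(a, b)`: both are locally integrable
there, and `∫ u φ' = - ∫ g φ` for every smooth `φ` with compact support in `(a, b)`. -/
def HasWeakDeriv (a b : ℝ) (u g : ℝ → ℝ) : Prop :=
  LocallyIntegrableOn u (Ioo a b) ∧ LocallyIntegrableOn g (Ioo a b) ∧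
    ∀ φ : ℝ → ℝ, ContDiff ℝ ∞ φ → HasCompactSupport φ → tsupport φ ⊆ Ioo a b →
      ∫ x in Ioo a b, u x * deriv φ x = -∫ x in Ioo a b, g x * φ x

open Classical in
/-- The weak derivative of `u` on `(a, b)` (unique up to equality almost everywhere on `(a, b)`;
the zero function if there is none). -/
def weakDeriv (a b : ℝ) (u : ℝ → ℝ) : ℝ → ℝ :=
  if h : ∃ g, HasWeakDeriv a b u g then h.choose else 0

/-- `u` is (the continuous representative on `[a, b]` of) an element of `H¹(a, b)`.
Only the values of `u` on `[a, b]` matter. -/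
def MemH1 (a b : ℝ) (u : ℝ → ℝ) : Prop :=
  ContinuousOn u (Icc a b) ∧ MemLp u 2 (volume.restrict (Ioo a b)) ∧
    ∃ g, HasWeakDeriv a b u g ∧ MemLp g 2 (volume.restrict (Ioo a b))

/-- `u` is (the continuous representative on `[a, b]` of) an element of `H¹₀(a, b)`. -/
def MemH10 (a b : ℝ) (u : ℝ → ℝ) : Prop :=
  MemH1 a b u ∧ u a = 0 ∧ u b = 0

/-- The norm of `L²(a, b)`. -/
def l2Norm (a b : ℝ) (u : ℝ → ℝ) : ℝ :=
  Real.sqrt (∫ x in Ioo a b, u x ^ 2)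

/-- The seminorm `|u|_{H¹(a, b)} = ‖u'‖_{L²(a, b)}`. -/
def h1Seminorm (a b : ℝ) (u : ℝ → ℝ) : ℝ :=
  l2Norm a b (weakDeriv a b u)

/-! ### The advection-diffusion problem on `(0, L)` -/

/-- The bilinear form `a(u, v) = ∫_0^L A u' v' + (b u') v`. -/
def aForm (L : ℝ) (A : ℝ → ℝ) (b : ℝ) (u v : ℝ → ℝ) : ℝ :=
  ∫ x in Ioo 0 L,
    (A x * weakDeriv 0 L u x * weakDeriv 0 L v x + b * weakDeriv 0 L u x * v x)

/-- The linear form `F(v) = ∫_0^L f v`. -/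
def loadForm (L : ℝ) (f v : ℝ → ℝ) : ℝ :=
  ∫ x in Ioo 0 L, f x * v x

/-- `u` is the weak solution of `-(A u')' + b u' = f` on `(0, L)`, `u(0) = u(L) = 0`. -/
def IsWeakSolution (L : ℝ) (A : ℝ → ℝ) (b : ℝ) (f u : ℝ → ℝ) : Prop :=
  MemH10 0 L u ∧ ∀ v, MemH10 0 L v → aForm L A b u v = loadForm L f v

/-! ### The coarse mesh and the multiscale space -/

/-- A mesh `0 = x_0 < x_1 < ... < x_n = L` of `(0, L)`, with elements `K_k = (x_k, x_{k+1})`,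
`k < n`. The values of `node` beyond the index `n` are irrelevant. -/
structure Mesh (L : ℝ) where
  n : ℕ
  node : ℕ → ℝ
  node_zero : node 0 = 0
  node_n : node n = L
  node_lt : ∀ k < n, node k < node (k + 1)

/-- The mesh size `H`, i.e. the largest length of an element. -/
def Mesh.size {L : ℝ} (T : Mesh L) : ℝ :=
  ⨆ k : Fin T.n, (T.node ((k : ℕ) + 1) - T.node (k : ℕ))

/-- The `ℙ¹` basis function of the interior node `x_{i+1}` (where `i + 1 < n`): the hat function
that is affine on each element, equals `1` at `x_{i+1}` and `0` at the other nodes. -/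
def Mesh.hat {L : ℝ} (T : Mesh L) (i : ℕ) (x : ℝ) : ℝ :=
  max 0 (min ((x - T.node i) / (T.node (i + 1) - T.node i))
    ((T.node (i + 2) - x) / (T.node (i + 2) - T.node (i + 1))))

/-- `ψ` is, on the element `(a, b)`, the weak solution in `H¹(a, b)` of the local problem
`-(A ψ')' = 0` with `ψ = φ` at the two end points. -/
def IsLocalSolution (a b : ℝ) (A φ ψ : ℝ → ℝ) : Prop :=
  MemH1 a b ψ ∧ ψ a = φ a ∧ ψ b = φ b ∧
    ∀ v, MemH10 a b v → ∫ x in Ioo a b, A x * weakDeriv a b ψ x * weakDeriv a b v x = 0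

/-- `ψ` is the (exact) multiscale basis function attached to the interior node `x_{i+1}`. -/
def IsMultiscaleBasis {L : ℝ} (T : Mesh L) (A : ℝ → ℝ) (i : ℕ) (ψ : ℝ → ℝ) : Prop :=
  ∀ k < T.n, IsLocalSolution (T.node k) (T.node (k + 1)) A (T.hat i) ψ

/-- The multiscale approximation space: the span of the multiscale basis functions attached to the
interior nodes. (Each basis function is unique on `[0, L]`; its values elsewhere are irrelevant.) -/
def msSpace {L : ℝ} (T : Mesh L) (A : ℝ → ℝ) : Submodule ℝ (ℝ → ℝ) :=
  Submodule.span ℝ {ψ | ∃ i, i + 1 < T.n ∧ IsMultiscaleBasis T A i ψ}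

/-! ### The SUPG stabilization -/

/-- `∑_K (τ_K (-(A u')' + b u'), b v')_{L²(K)}`, the derivative of the flux `A u'` being the weak
derivative inside the element `K`. -/
def aStab {L : ℝ} (T : Mesh L) (A : ℝ → ℝ) (b : ℝ) (τ : ℕ → ℝ) (u v : ℝ → ℝ) : ℝ :=
  ∑ k ∈ Finset.range T.n, ∫ x in Ioo (T.node k) (T.node (k + 1)),
    τ k *
      (-weakDeriv (T.node k) (T.node (k + 1)) (fun y => A y * weakDeriv 0 L u y) x
        + b * weakDeriv 0 L u x) *
      (b * weakDeriv 0 L v x)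

/-- `∑_K (τ_K f, b v')_{L²(K)}`. -/
def loadStab {L : ℝ} (T : Mesh L) (b : ℝ) (τ : ℕ → ℝ) (f v : ℝ → ℝ) : ℝ :=
  ∑ k ∈ Finset.range T.n, ∫ x in Ioo (T.node k) (T.node (k + 1)),
    τ k * f x * (b * weakDeriv 0 L v x)

/-- `uH` is the solution of the SUPG-stabilized multiscale finite element method. -/
def IsStabMsFEMSolution {L : ℝ} (T : Mesh L) (A : ℝ → ℝ) (b : ℝ) (τ : ℕ → ℝ)
    (f uH : ℝ → ℝ) : Prop :=
  uH ∈ msSpace T A ∧ ∀ v ∈ msSpace T A,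
    aForm L A b uH v + aStab T A b τ uH v = loadForm L f v + loadStab T b τ f v

end StabMsFEM

end

noncomputable section

namespace StabMsFEM

/-! ### Weak derivatives and absolutely continuous functions -/

/-! The proof compares `u` and `uH` with the nodal interpolant `v` of `u` in the multiscale space.
Put `e = u - v`, `w = uH - v`, `R = ‖f - b u'‖` and `H = T.size`.

One dimension gives two facts. The flux `A z'` of any `z` in the multiscale space is constant on
each element. Hence `z` is `A`-orthogonal to every `H¹₀` function vanishing at the nodes, in
particular to `e`. For the same reason the second-order part of the stabilization vanishes, and SUPG
only adds the diffusion `τ b² ∫ u' v'` to the left-hand side.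

Interpolation (`interpolation_error`): testing the equation with `e` and using orthogonality gives
`∫ A e' e' = ∫ (f - b u') e`. Poincaré on each element costs a factor `H`, so `α₁ ‖e'‖ ≤ H R`.

Consistency (`discrete_error`): subtracting the two problems and testing with `w` leaves only terms
in `e` and `R`. The added diffusion controls `‖w'‖`, and the choice of `τ` gives `|b| ‖w'‖ ≤ 3 |b|
‖e'‖ + R`.

A priori bound: the advection term is skew-symmetric, so the energy is at most `‖f‖ ‖u‖`. Testing
with `x u` gives `|b| ‖u‖ ≤ 12 L ‖f‖` when `α₂ ≤ |b| L`. Together they bound `R` by a multiple of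
`(1 + √(2 α₂ L |b|) / α₁) ‖f‖`.

Since `|b| H ≥ 2 α₁`, the term `R / |b|` is at most `H R / (2 α₁)`, and everything is a multiple of
`H R / α₁`. The factor containing `α₂² / α₁² + |b| H / α₁` enters only as a number at least `1`.

All of this is carried out with classical derivatives of absolutely continuous functions, to which
weak derivatives are first reduced (`memH1_iff`, `weakDeriv_ae_eq_deriv`). -/

lemma absolutelyContinuousOnInterval_congr {a b : ℝ} {u v : ℝ → ℝ}
    (hu : AbsolutelyContinuousOnInterval u a b) (h : EqOn u v (uIcc a b)) :
    AbsolutelyContinuousOnInterval v a b := by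
  rw [absolutelyContinuousOnInterval_iff] at hu ⊢
  intro ε hε
  obtain ⟨δ, hδ, H⟩ := hu ε hε
  refine ⟨δ, hδ, fun E hE hlt => ?_⟩
  have := H E hE hlt
  rwa [Finset.sum_congr rfl fun i hi => by
    rw [h (hE.1 i hi).1, h (hE.1 i hi).2]] at this

lemma deriv_eqOn_Ioo {a b : ℝ} {u v : ℝ → ℝ} (h : EqOn u v (Icc a b)) :
    EqOn (deriv u) (deriv v) (Ioo a b) := fun _ hx =>
  Filter.EventuallyEq.deriv_eq <|
    Filter.eventuallyEq_of_mem (isOpen_Ioo.mem_nhds hx) (h.mono Ioo_subset_Icc_self)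

lemma ContinuousOn.memLp_Ioo {a b : ℝ} {u : ℝ → ℝ} (h : ContinuousOn u (Icc a b))
    (p : ENNReal) : MemLp u p (volume.restrict (Ioo a b)) := by
  obtain ⟨C, hC⟩ := isCompact_Icc.exists_bound_of_continuousOn h
  refine MemLp.of_bound ((h.mono Ioo_subset_Icc_self).aestronglyMeasurable measurableSet_Ioo) C ?_
  exact (ae_restrict_mem measurableSet_Ioo).mono fun x hx => hC x (Ioo_subset_Icc_self hx)

lemma intervalIntegral_eq_setIntegral_Ioo {a b : ℝ} (hab : a ≤ b) (g : ℝ → ℝ) :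
    ∫ x in a..b, g x = ∫ x in Ioo a b, g x := by
  rw [intervalIntegral.integral_of_le hab, integral_Ioc_eq_integral_Ioo]

lemma intervalIntegrable_iff_integrable_Ioo {a b : ℝ} (hab : a ≤ b) (g : ℝ → ℝ) :
    IntervalIntegrable g volume a b ↔ Integrable g (volume.restrict (Ioo a b)) := by
  rw [intervalIntegrable_iff_integrableOn_Ioo_of_le hab]; rfl

lemma eq_zero_of_tsupport_subset {φ : ℝ → ℝ} {s : Set ℝ} (h : tsupport φ ⊆ s) {x : ℝ}
    (hx : x ∉ s) : φ x = 0 :=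
  image_eq_zero_of_notMem_tsupport fun hx' => hx (h hx')

/-- Integration by parts against a test function. -/
lemma hasWeakDeriv_deriv {a b : ℝ} (hab : a ≤ b) {u : ℝ → ℝ}
    (hu : AbsolutelyContinuousOnInterval u a b) : HasWeakDeriv a b u (deriv u) := by
  have hc : ContinuousOn u (Icc a b) := by simpa [uIcc_of_le hab] using hu.continuousOn
  refine ⟨?_, ?_, fun φ hφ _ hs => ?_⟩
  · exact IntegrableOn.locallyIntegrableOn
      (memLp_one_iff_integrable.1 (ContinuousOn.memLp_Ioo hc 1))
  · exact IntegrableOn.locallyIntegrableOn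
      ((intervalIntegrable_iff_integrable_Ioo hab _).1 hu.intervalIntegrable_deriv)
  · have hφ' : AbsolutelyContinuousOnInterval φ a b :=
      ((hφ.of_le (by simp)).contDiffOn).absolutelyContinuousOnInterval
    have := hu.integral_mul_deriv_eq_deriv_mul hφ'
    rw [eq_zero_of_tsupport_subset hs (by simp : a ∉ Ioo a b),
      eq_zero_of_tsupport_subset hs (by simp : b ∉ Ioo a b),
      intervalIntegral_eq_setIntegral_Ioo hab, intervalIntegral_eq_setIntegral_Ioo hab] at this
    simpa using this

lemma setIntegral_mul_eq_integral_of_tsupport {s : Set ℝ} {φ g : ℝ → ℝ} (h : tsupport φ ⊆ s) :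
    ∫ x in s, g x * φ x = ∫ x, φ x • g x := by
  rw [setIntegral_eq_integral_of_forall_compl_eq_zero]
  · simp [mul_comm]
  · intro x hx; simp [eq_zero_of_tsupport_subset h hx]

lemma LocallyIntegrableOn.integrable_mul_test {a b : ℝ} {g φ : ℝ → ℝ}
    (hg : LocallyIntegrableOn g (Ioo a b)) (hφ : Continuous φ) (hc : HasCompactSupport φ)
    (hs : tsupport φ ⊆ Ioo a b) : Integrable (fun x => g x * φ x) := by
  have h1 : IntegrableOn g (tsupport φ) := hg.integrableOn_compact_subset hs hc
  have h2 : IntegrableOn (fun x => g x * φ x) (tsupport φ) :=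
    h1.mul_continuousOn hφ.continuousOn hc
  rwa [integrableOn_iff_integrable_of_support_subset] at h2
  intro x hx
  exact subset_tsupport _ (fun h => hx (by simp [h]))

/-- Fundamental lemma of the calculus of variations, applied to the difference. As `weakDeriv` is an
arbitrary choice, this is what makes it usable under integrals. -/
lemma HasWeakDeriv.ae_eq {a b : ℝ} {u g₁ g₂ : ℝ → ℝ}
    (h₁ : HasWeakDeriv a b u g₁) (h₂ : HasWeakDeriv a b u g₂) :
    g₁ =ᵐ[volume.restrict (Ioo a b)] g₂ := by
  have key : ∀ᵐ x, x ∈ Ioo a b → (g₁ - g₂) x = 0 := by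
    refine isOpen_Ioo.ae_eq_zero_of_integral_contDiff_smul_eq_zero (h₁.2.1.sub h₂.2.1) ?_
    intro φ hφ hc hs
    rw [← setIntegral_mul_eq_integral_of_tsupport hs]
    have e1 := h₁.2.2 φ hφ hc hs
    have e2 := h₂.2.2 φ hφ hc hs
    simp only [Pi.sub_apply, sub_mul]
    rw [integral_sub (LocallyIntegrableOn.integrable_mul_test h₁.2.1 hφ.continuous hc hs).restrict
      (LocallyIntegrableOn.integrable_mul_test h₂.2.1 hφ.continuous hc hs).restrict]
    linarith
  rw [Filter.EventuallyEq, ae_restrict_iff' measurableSet_Ioo]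
  filter_upwards [key] with x hx hxs
  exact sub_eq_zero.1 (hx hxs)

lemma HasWeakDeriv.weakDeriv_ae_eq {a b : ℝ} {u g : ℝ → ℝ} (h : HasWeakDeriv a b u g) :
    weakDeriv a b u =ᵐ[volume.restrict (Ioo a b)] g := by
  have hex : ∃ g, HasWeakDeriv a b u g := ⟨g, h⟩
  rw [weakDeriv, dif_pos hex]
  exact HasWeakDeriv.ae_eq hex.choose_spec h

/-! ### Functions with vanishing weak derivative -/

lemma exists_contDiff_bump_integral_one {a b : ℝ} (hab : a < b) :
    ∃ ρ : ℝ → ℝ, ContDiff ℝ ∞ ρ ∧ HasCompactSupport ρ ∧ tsupport ρ ⊆ Ioo a b ∧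
      ∫ x, ρ x = 1 := by
  let f : ContDiffBump ((a + b) / 2) :=
    ⟨(b - a) / 8, (b - a) / 4, by linarith, by linarith⟩
  refine ⟨f.normed volume, f.contDiff_normed, f.hasCompactSupport_normed, ?_, f.integral_normed⟩
  rw [f.tsupport_normed_eq, Real.closedBall_eq_Icc]
  intro x hx
  simp only [mem_Icc, f] at hx
  constructor <;> linarith [hx.1, hx.2]

/-- A test function with zero mean is the derivative of a test function. -/
lemma exists_primitive_test {a b : ℝ} {η : ℝ → ℝ} (hη : ContDiff ℝ ∞ η)
    (hc : HasCompactSupport η) (hs : tsupport η ⊆ Ioo a b) (h0 : ∫ x, η x = 0) :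
    ∃ φ : ℝ → ℝ, ContDiff ℝ ∞ φ ∧ HasCompactSupport φ ∧ tsupport φ ⊆ Ioo a b ∧
      deriv φ = η := by
  have hder : ∀ x, HasDerivAt (fun x => ∫ t in a..x, η t) (η x) x := fun x =>
    intervalIntegral.integral_hasDerivAt_right (hη.continuous.intervalIntegrable _ _)
      hη.continuous.stronglyMeasurable.stronglyMeasurableAtFilter hη.continuous.continuousAt
  have hd : deriv (fun x => ∫ t in a..x, η t) = η := funext fun x => (hder x).deriv
  obtain ⟨c, d, hcd, hac, hdb⟩ : ∃ c d, tsupport η ⊆ Icc c d ∧ a < c ∧ d < b := by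
    rcases (tsupport η).eq_empty_or_nonempty with he | hne
    -- With empty support, any endpoints with `a < c` and `d < b` serve; `Icc c d` may itself be
    -- empty.
    · exact ⟨a + 1, b - 1, by simp [he], by linarith, by linarith⟩
    · have hK : IsCompact (tsupport η) := hc
      exact ⟨sInf (tsupport η), sSup (tsupport η),
        fun x hx => ⟨csInf_le hK.bddBelow hx, le_csSup hK.bddAbove hx⟩,
        (hs (hK.sInf_mem hne)).1, (hs (hK.sSup_mem hne)).2⟩
  have hsub : Function.support (fun x => ∫ t in a..x, η t) ⊆ Icc c d := by
    intro x hx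
    by_contra hxn
    apply hx
    rw [mem_Icc, not_and_or, not_le, not_le] at hxn
    rcases hxn with hxc | hxd
    · refine intervalIntegral.integral_zero_ae (Filter.Eventually.of_forall fun t ht => ?_)
      refine eq_zero_of_tsupport_subset hcd fun h' => ?_
      rcases le_max_iff.1 ht.2 with h | h <;> linarith [h'.1]
    -- To the right of the support the primitive equals the full integral of `η`; this is where zero
    -- mean is used.
    · have hax : Function.support η ⊆ Ioc (min a c) x := by
        intro t ht
        have h1 := hs (subset_tsupport _ ht)
        have h2 := hcd (subset_tsupport _ ht)
        exact ⟨(min_le_left _ _).trans_lt h1.1, h2.2.trans hxd.le⟩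
      rw [min_eq_left hac.le] at hax
      show ∫ t in a..x, η t = 0
      rw [intervalIntegral.integral_eq_integral_of_support_subset hax, h0]
  have hts : tsupport (fun x => ∫ t in a..x, η t) ⊆ Icc c d := closure_minimal hsub isClosed_Icc
  refine ⟨fun x => ∫ t in a..x, η t, ?_, ?_, ?_, hd⟩
  · rw [contDiff_infty_iff_deriv]
    exact ⟨fun x => (hder x).differentiableAt, by rwa [hd]⟩
  · exact isCompact_Icc.of_isClosed_subset isClosed_closure hts
  · exact hts.trans (Icc_subset_Ioo hac hdb)

/-- The du Bois-Reymond lemma. -/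
lemma ae_const_of_weakDeriv_zero {a b : ℝ} (hab : a < b) {w : ℝ → ℝ}
    (hw : LocallyIntegrableOn w (Ioo a b))
    (h : ∀ φ : ℝ → ℝ, ContDiff ℝ ∞ φ → HasCompactSupport φ → tsupport φ ⊆ Ioo a b →
      ∫ x in Ioo a b, w x * deriv φ x = 0) :
    ∃ c, ∀ᵐ x, x ∈ Ioo a b → w x = c := by
  obtain ⟨ρ, hρ, hρc, hρs, hρ1⟩ := exists_contDiff_bump_integral_one hab
  -- The constant is the average of `w` against `ρ`. For any test function `ψ`, subtracting `(∫ ψ)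
  -- ρ` leaves zero mean, hence the derivative of a test function, against which `w` integrates to
  -- zero.
  refine ⟨∫ x, w x * ρ x, ?_⟩
  set c := ∫ x, w x * ρ x with hcdef
  have key : ∀ᵐ x, x ∈ Ioo a b → w x - c = 0 := by
    refine isOpen_Ioo.ae_eq_zero_of_integral_contDiff_smul_eq_zero
      (hw.sub ((locallyIntegrable_const c).locallyIntegrableOn _)) ?_
    intro ψ hψ hψc hψs
    set m := ∫ x, ψ x with hm
    have iψ : Integrable ψ := hψ.continuous.integrable_of_hasCompactSupport hψc
    have iρ : Integrable ρ := hρ.continuous.integrable_of_hasCompactSupport hρc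
    have hs : tsupport (fun x => ψ x - m * ρ x) ⊆ Ioo a b := by
      refine (closure_minimal ?_ ((isClosed_tsupport ψ).union (isClosed_tsupport ρ))).trans
        (union_subset hψs hρs)
      intro x hx
      by_contra hn
      rw [mem_union, not_or] at hn
      exact hx (by simp [image_eq_zero_of_notMem_tsupport hn.1,
        image_eq_zero_of_notMem_tsupport hn.2])
    have hcs : HasCompactSupport (fun x => ψ x - m * ρ x) := hψc.sub hρc.mul_left
    obtain ⟨φ, hφ, hφc, hφs, hφd⟩ := exists_primitive_test (η := fun x => ψ x - m * ρ x)
      (hψ.sub (contDiff_const.mul hρ)) hcs hs (by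
        rw [integral_sub iψ (iρ.const_mul m), integral_const_mul, hρ1]; simp [hm])
    have e := h φ hφ hφc hφs
    rw [hφd, setIntegral_eq_integral_of_forall_compl_eq_zero (fun x hx => by
      exact mul_eq_zero_of_right _ (eq_zero_of_tsupport_subset hs hx))] at e
    have i1 := LocallyIntegrableOn.integrable_mul_test hw hψ.continuous hψc hψs
    have i2 := LocallyIntegrableOn.integrable_mul_test hw hρ.continuous hρc hρs
    have e1 : ∫ x, w x * (ψ x - m * ρ x) = (∫ x, w x * ψ x) - m * c := by
      rw [hcdef, ← integral_const_mul, ← integral_sub i1 (i2.const_mul m)]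
      congr 1; ext x; ring
    have e2 : ∫ x, ψ x • (w x - c) = (∫ x, w x * ψ x) - c * m := by
      rw [hm, ← integral_const_mul, ← integral_sub i1 (iψ.const_mul c)]
      congr 1; ext x; simp; ring
    rw [e2]; rw [e1] at e; linarith
  filter_upwards [key] with x hx hxs
  exact sub_eq_zero.1 (hx hxs)

lemma ContinuousOn.eqOn_Icc_of_ae {a b c : ℝ} (hab : a < b) {w : ℝ → ℝ}
    (hw : ContinuousOn w (Icc a b)) (h : ∀ᵐ x, x ∈ Ioo a b → w x = c) :
    EqOn w (fun _ => c) (Icc a b) := by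
  have h1 : EqOn w (fun _ => c) (Ioo a b) := by
    refine Measure.eqOn_open_of_ae_eq (μ := volume) ?_ isOpen_Ioo (hw.mono Ioo_subset_Icc_self)
      continuousOn_const
    rwa [Filter.EventuallyEq, ae_restrict_iff' measurableSet_Ioo]
  have := h1.of_subset_closure hw continuousOn_const Ioo_subset_Icc_self
    (by rw [closure_Ioo hab.ne])
  exact this

/-! ### `H¹` functions as absolutely continuous functions -/

lemma primitive_absolutelyContinuous {a b : ℝ} (hab : a ≤ b) {g : ℝ → ℝ}
    (hg : Integrable g (volume.restrict (Ioo a b))) :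
    AbsolutelyContinuousOnInterval (fun x => ∫ t in a..x, g t) a b :=
  ((intervalIntegrable_iff_integrable_Ioo hab g).2
    hg).absolutelyContinuousOnInterval_intervalIntegral left_mem_uIcc

lemma deriv_primitive_ae_eq {a b : ℝ} (hab : a ≤ b) {g : ℝ → ℝ}
    (hg : Integrable g (volume.restrict (Ioo a b))) :
    deriv (fun x => ∫ t in a..x, g t) =ᵐ[volume.restrict (Ioo a b)] g := by
  rw [Filter.EventuallyEq, ae_restrict_iff' measurableSet_Ioo]
  filter_upwards [((intervalIntegrable_iff_integrable_Ioo hab g).2 hg).ae_hasDerivAt_integral]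
    with x hx hxs
  exact (hx (by rw [uIcc_of_le hab]; exact Ioo_subset_Icc_self hxs) a left_mem_uIcc).deriv

/-- The difference between `u` and a primitive `G` of its weak derivative has zero weak derivative.
It is therefore constant almost everywhere, and by continuity on all of `[a, b]`; so `u` inherits
the regularity of `G`. -/
lemma MemH1.absolutelyContinuous {a b : ℝ} (hab : a < b) {u : ℝ → ℝ} (h : MemH1 a b u) :
    AbsolutelyContinuousOnInterval u a b ∧ MemLp (deriv u) 2 (volume.restrict (Ioo a b)) := by
  obtain ⟨hc, -, g, hg, hg2⟩ := h
  have hgi : Integrable g (volume.restrict (Ioo a b)) := hg2.integrable (by norm_num)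
  set G : ℝ → ℝ := fun x => ∫ t in a..x, g t with hG
  have hGac : AbsolutelyContinuousOnInterval G a b := primitive_absolutelyContinuous hab.le hgi
  have hGd : deriv G =ᵐ[volume.restrict (Ioo a b)] g := deriv_primitive_ae_eq hab.le hgi
  have hGw := hasWeakDeriv_deriv hab.le hGac
  have hGc : ContinuousOn G (Icc a b) := by simpa [uIcc_of_le hab.le] using hGac.continuousOn
  obtain ⟨c, hcw⟩ := ae_const_of_weakDeriv_zero hab (w := u - G) (hg.1.sub hGw.1) (by
    intro φ hφ hφc hφs
    have hd : tsupport (deriv φ) ⊆ Ioo a b := (tsupport_deriv_subset (𝕜 := ℝ)).trans hφs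
    have hdc : Continuous (deriv φ) := hφ.continuous_deriv (by simp)
    simp only [Pi.sub_apply, sub_mul]
    rw [integral_sub
      (LocallyIntegrableOn.integrable_mul_test hg.1 hdc hφc.deriv hd).restrict
      (LocallyIntegrableOn.integrable_mul_test hGw.1 hdc hφc.deriv hd).restrict,
      hg.2.2 φ hφ hφc hφs, hGw.2.2 φ hφ hφc hφs, sub_eq_zero, neg_inj]
    refine integral_congr_ae ?_
    filter_upwards [hGd] with x hx
    rw [hx])
  have heq := ContinuousOn.eqOn_Icc_of_ae hab (hc.sub hGc) hcw
  have heq' : EqOn (fun x => G x + c) u (Icc a b) := by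
    intro x hx
    have := heq hx
    simp only [Pi.sub_apply] at this
    show G x + c = u x
    linarith
  refine ⟨absolutelyContinuousOnInterval_congr
    (u := fun x => G x + c)
    (hGac.add (contDiff_const (c := c)).contDiffOn.absolutelyContinuousOnInterval)
    (by rwa [uIcc_of_le hab.le]), ?_⟩
  refine (memLp_congr_ae ?_).1 hg2
  filter_upwards [hGd, ae_restrict_mem measurableSet_Ioo] with x hx hxs
  rw [← deriv_eqOn_Ioo heq' hxs, ← hx]
  simp

lemma memH1_iff {a b : ℝ} (hab : a < b) {u : ℝ → ℝ} :
    MemH1 a b u ↔ AbsolutelyContinuousOnInterval u a b ∧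
      MemLp (deriv u) 2 (volume.restrict (Ioo a b)) := by
  refine ⟨fun h => h.absolutelyContinuous hab, fun h => ?_⟩
  have hc : ContinuousOn u (Icc a b) := by simpa [uIcc_of_le hab.le] using h.1.continuousOn
  exact ⟨hc, ContinuousOn.memLp_Ioo hc 2, deriv u, hasWeakDeriv_deriv hab.le h.1, h.2⟩

lemma weakDeriv_ae_eq_deriv {a b : ℝ} (hab : a ≤ b) {u : ℝ → ℝ}
    (hu : AbsolutelyContinuousOnInterval u a b) :
    weakDeriv a b u =ᵐ[volume.restrict (Ioo a b)] deriv u :=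
  (hasWeakDeriv_deriv hab hu).weakDeriv_ae_eq


/-! ### The `L²` norm -/

lemma l2Norm_nonneg (a b : ℝ) (u : ℝ → ℝ) : 0 ≤ l2Norm a b u := Real.sqrt_nonneg _

lemma l2Norm_sq (a b : ℝ) (u : ℝ → ℝ) : l2Norm a b u ^ 2 = ∫ x in Ioo a b, u x ^ 2 :=
  Real.sq_sqrt (integral_nonneg fun _ => sq_nonneg _)

lemma l2Norm_congr {a b : ℝ} {u v : ℝ → ℝ} (h : u =ᵐ[volume.restrict (Ioo a b)] v) :
    l2Norm a b u = l2Norm a b v := by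
  unfold l2Norm
  congr 1
  refine integral_congr_ae ?_
  filter_upwards [h] with x hx
  rw [hx]

lemma integral_mul_eq_inner {a b : ℝ} {f g : ℝ → ℝ} (hf : MemLp f 2 (volume.restrict (Ioo a b)))
    (hg : MemLp g 2 (volume.restrict (Ioo a b))) :
    ∫ x in Ioo a b, f x * g x = inner ℝ (hf.toLp f) (hg.toLp g) := by
  rw [L2.inner_def]
  refine integral_congr_ae ?_
  filter_upwards [hf.coeFn_toLp, hg.coeFn_toLp] with x h1 h2
  rw [h1, h2]
  simp [mul_comm]

lemma l2Norm_eq_norm {a b : ℝ} {f : ℝ → ℝ} (hf : MemLp f 2 (volume.restrict (Ioo a b))) :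
    l2Norm a b f = ‖hf.toLp f‖ := by
  rw [l2Norm, norm_eq_sqrt_real_inner, ← integral_mul_eq_inner hf hf]
  simp only [sq]

lemma abs_integral_mul_le {a b : ℝ} {f g : ℝ → ℝ} (hf : MemLp f 2 (volume.restrict (Ioo a b)))
    (hg : MemLp g 2 (volume.restrict (Ioo a b))) :
    |∫ x in Ioo a b, f x * g x| ≤ l2Norm a b f * l2Norm a b g := by
  rw [integral_mul_eq_inner hf hg, l2Norm_eq_norm hf, l2Norm_eq_norm hg]
  exact abs_real_inner_le_norm _ _

lemma l2Norm_add_le {a b : ℝ} {f g : ℝ → ℝ} (hf : MemLp f 2 (volume.restrict (Ioo a b)))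
    (hg : MemLp g 2 (volume.restrict (Ioo a b))) :
    l2Norm a b (fun x => f x + g x) ≤ l2Norm a b f + l2Norm a b g := by
  have : l2Norm a b (f + g) ≤ l2Norm a b f + l2Norm a b g := by
    rw [l2Norm_eq_norm (hf.add hg), l2Norm_eq_norm hf, l2Norm_eq_norm hg, MemLp.toLp_add]
    exact norm_add_le _ _
  exact this

lemma l2Norm_const_mul (a b c : ℝ) (f : ℝ → ℝ) :
    l2Norm a b (fun x => c * f x) = |c| * l2Norm a b f := by
  simp only [l2Norm, mul_pow, integral_const_mul]
  rw [Real.sqrt_mul (sq_nonneg c), Real.sqrt_sq_eq_abs]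

lemma l2Norm_sub_le {a b : ℝ} {f g : ℝ → ℝ} (hf : MemLp f 2 (volume.restrict (Ioo a b)))
    (hg : MemLp g 2 (volume.restrict (Ioo a b))) :
    l2Norm a b (fun x => f x - g x) ≤ l2Norm a b f + l2Norm a b g := by
  have h := l2Norm_add_le hf (hg.const_mul (-1))
  rw [l2Norm_const_mul] at h
  simpa [sub_eq_add_neg] using h

lemma integrable_mul_fun {a b : ℝ} {f g : ℝ → ℝ} (hf : MemLp f 2 (volume.restrict (Ioo a b)))
    (hg : MemLp g 2 (volume.restrict (Ioo a b))) :
    Integrable (fun x => f x * g x) (volume.restrict (Ioo a b)) :=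
  hf.integrable_mul hg

/-! ### The space `H¹₀` -/

/-- `u` is absolutely continuous on `[a, b]` with square integrable derivative, and vanishes at the
end points. -/
structure IsH10 (a b : ℝ) (u : ℝ → ℝ) : Prop where
  ac : AbsolutelyContinuousOnInterval u a b
  memLp_deriv : MemLp (deriv u) 2 (volume.restrict (Ioo a b))
  left : u a = 0
  right : u b = 0

lemma memH10_iff_isH10 {a b : ℝ} (hab : a < b) {u : ℝ → ℝ} : MemH10 a b u ↔ IsH10 a b u := by
  rw [MemH10, memH1_iff hab]
  exact ⟨fun ⟨⟨h1, h2⟩, h3, h4⟩ => ⟨h1, h2, h3, h4⟩, fun ⟨h1, h2, h3, h4⟩ => ⟨⟨h1, h2⟩, h3, h4⟩⟩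

lemma AbsolutelyContinuousOnInterval.memLp_Ioo {a b : ℝ} (hab : a ≤ b) {u : ℝ → ℝ}
    (hu : AbsolutelyContinuousOnInterval u a b) : MemLp u 2 (volume.restrict (Ioo a b)) :=
  ContinuousOn.memLp_Ioo (by simpa [uIcc_of_le hab] using hu.continuousOn) 2

lemma AbsolutelyContinuousOnInterval.ae_differentiableAt_Ioo {a b : ℝ} {u : ℝ → ℝ} (hab : a ≤ b)
    (hu : AbsolutelyContinuousOnInterval u a b) :
    ∀ᵐ x ∂(volume.restrict (Ioo a b)), DifferentiableAt ℝ u x := by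
  rw [ae_restrict_iff' measurableSet_Ioo]
  filter_upwards [hu.ae_differentiableAt] with x hx hxs
  exact hx (by rw [uIcc_of_le hab]; exact Ioo_subset_Icc_self hxs)

lemma deriv_add_ae_eq {a b : ℝ} (hab : a ≤ b) {u v : ℝ → ℝ}
    (hu : AbsolutelyContinuousOnInterval u a b) (hv : AbsolutelyContinuousOnInterval v a b) :
    deriv (u + v) =ᵐ[volume.restrict (Ioo a b)] fun x => deriv u x + deriv v x := by
  filter_upwards [AbsolutelyContinuousOnInterval.ae_differentiableAt_Ioo hab hu,
    AbsolutelyContinuousOnInterval.ae_differentiableAt_Ioo hab hv] with x h1 h2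
  exact deriv_add h1 h2

lemma deriv_sub_ae_eq {a b : ℝ} (hab : a ≤ b) {u v : ℝ → ℝ}
    (hu : AbsolutelyContinuousOnInterval u a b) (hv : AbsolutelyContinuousOnInterval v a b) :
    deriv (u - v) =ᵐ[volume.restrict (Ioo a b)] fun x => deriv u x - deriv v x := by
  filter_upwards [AbsolutelyContinuousOnInterval.ae_differentiableAt_Ioo hab hu,
    AbsolutelyContinuousOnInterval.ae_differentiableAt_Ioo hab hv] with x h1 h2
  exact deriv_sub h1 h2

lemma IsH10.sub {a b : ℝ} (hab : a ≤ b) {u v : ℝ → ℝ} (hu : IsH10 a b u) (hv : IsH10 a b v) :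
    IsH10 a b (u - v) where
  ac := hu.ac.sub hv.ac
  memLp_deriv := (memLp_congr_ae (deriv_sub_ae_eq hab hu.ac hv.ac)).2
    (hu.memLp_deriv.sub hv.memLp_deriv)
  left := by simp [hu.left, hv.left]
  right := by simp [hu.right, hv.right]

lemma IsH10.memLp {a b : ℝ} (hab : a ≤ b) {u : ℝ → ℝ} (hu : IsH10 a b u) :
    MemLp u 2 (volume.restrict (Ioo a b)) :=
  AbsolutelyContinuousOnInterval.memLp_Ioo hab hu.ac

lemma IsH10.integral_deriv_mul {a b : ℝ} (hab : a ≤ b) {u v : ℝ → ℝ}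
    (hu : AbsolutelyContinuousOnInterval u a b) (hv : IsH10 a b v) :
    ∫ x in Ioo a b, deriv u x * v x = -∫ x in Ioo a b, u x * deriv v x := by
  have := hu.integral_mul_deriv_eq_deriv_mul hv.ac
  rw [hv.left, hv.right, intervalIntegral_eq_setIntegral_Ioo hab,
    intervalIntegral_eq_setIntegral_Ioo hab] at this
  linarith

/-- Skew-symmetry of advection: the term contributes nothing to the energy. -/
lemma IsH10.integral_deriv_mul_self {a b : ℝ} (hab : a ≤ b) {u : ℝ → ℝ} (hu : IsH10 a b u) :
    ∫ x in Ioo a b, deriv u x * u x = 0 := by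
  have := IsH10.integral_deriv_mul hab hu.ac hu
  simp only [mul_comm (u _)] at this
  linarith

/-- `H¹₀(0, L)` is stable under multiplication by `x`. -/
lemma IsH10.id_mul {L : ℝ} (hL : 0 ≤ L) {u : ℝ → ℝ} (hu : IsH10 0 L u) :
    IsH10 0 L (fun x => x * u x) ∧
      deriv (fun x => x * u x) =ᵐ[volume.restrict (Ioo 0 L)] fun x => u x + x * deriv u x := by
  have hid : AbsolutelyContinuousOnInterval (fun x : ℝ => x) 0 L :=
    (contDiff_id.contDiffOn).absolutelyContinuousOnInterval
  have hd : deriv (fun x => x * u x) =ᵐ[volume.restrict (Ioo 0 L)]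
      fun x => u x + x * deriv u x := by
    filter_upwards [AbsolutelyContinuousOnInterval.ae_differentiableAt_Ioo hL hu.ac] with x h1
    have := (hasDerivAt_id' x).fun_mul h1.hasDerivAt
    rw [this.deriv, one_mul]
  refine ⟨⟨hid.mul hu.ac, ?_, by simp, by simp [hu.right]⟩, hd⟩
  refine (memLp_congr_ae hd).2 ((hu.memLp hL).add ?_)
  refine MemLp.of_le_mul (c := L) hu.memLp_deriv
    (measurable_id.aestronglyMeasurable.mul hu.memLp_deriv.1) ?_
  filter_upwards [ae_restrict_mem measurableSet_Ioo] with x hx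
  rw [norm_mul, Real.norm_of_nonneg hx.1.le]
  exact mul_le_mul_of_nonneg_right hx.2.le (norm_nonneg _)

/-- Poincaré's inequality. -/
lemma integral_sq_le_of_left_eq_zero {a b : ℝ} (hab : a ≤ b) {u : ℝ → ℝ}
    (hu : AbsolutelyContinuousOnInterval u a b)
    (hd : MemLp (deriv u) 2 (volume.restrict (Ioo a b))) (h0 : u a = 0) :
    ∫ x in Ioo a b, u x ^ 2 ≤ (b - a) ^ 2 * ∫ x in Ioo a b, deriv u x ^ 2 := by
  -- Cauchy–Schwarz against the constant `1` in `u x = ∫ u'`; integrating this pointwise bound gives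
  -- the second factor `b - a`.
  have hpt : ∀ x ∈ Ioo a b, u x ^ 2 ≤ (b - a) * ∫ x in Ioo a b, deriv u x ^ 2 := by
    intro x hx
    have hux : u x = ∫ t in Ioo a x, deriv u t := by
      rw [← intervalIntegral_eq_setIntegral_Ioo hx.1.le,
        (hu.mono (by rw [uIcc_of_le hab, uIcc_of_le hx.1.le]
                     exact Icc_subset_Icc_right hx.2.le)).integral_deriv_eq_sub, h0, sub_zero]
    have hd' : MemLp (deriv u) 2 (volume.restrict (Ioo a x)) :=
      hd.mono_measure (Measure.restrict_mono (Ioo_subset_Ioo_right hx.2.le) le_rfl)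
    have h1 := abs_integral_mul_le (a := a) (b := x) (memLp_const (1 : ℝ)) hd'
    simp only [one_mul] at h1
    rw [← hux] at h1
    have h2 : u x ^ 2 ≤ (l2Norm a x (fun _ => 1) * l2Norm a x (deriv u)) ^ 2 := by
      rw [← sq_abs]; exact pow_le_pow_left₀ (abs_nonneg _) h1 2
    rw [mul_pow, l2Norm_sq, l2Norm_sq] at h2
    have h3 : ∫ t in Ioo a x, (1 : ℝ) ^ 2 = x - a := by
      simp [hx.1.le]
    rw [h3] at h2
    refine h2.trans (mul_le_mul (by linarith [hx.2]) ?_ (integral_nonneg fun _ => sq_nonneg _)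
      (by linarith))
    exact setIntegral_mono_set hd.integrable_sq (ae_of_all _ fun _ => sq_nonneg _)
      (Ioo_subset_Ioo_right hx.2.le).eventuallyLE
  calc ∫ x in Ioo a b, u x ^ 2
      ≤ ∫ x in Ioo a b, ((b - a) * ∫ x in Ioo a b, deriv u x ^ 2) :=
        setIntegral_mono_on (AbsolutelyContinuousOnInterval.memLp_Ioo hab hu).integrable_sq
          (integrableOn_const (by simp)) measurableSet_Ioo hpt
    _ = _ := by
        simp [hab]; ring

/-! ### The coefficient -/

lemma memLp_coef_mul {a b α₁ α₂ : ℝ} (hα : 0 < α₁) {A g : ℝ → ℝ}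
    (hA : AEStronglyMeasurable A (volume.restrict (Ioo a b)))
    (hb : ∀ᵐ x ∂(volume.restrict (Ioo a b)), α₁ ≤ A x ∧ A x ≤ α₂)
    (hg : MemLp g 2 (volume.restrict (Ioo a b))) :
    MemLp (fun x => A x * g x) 2 (volume.restrict (Ioo a b)) := by
  refine MemLp.of_le_mul (c := α₂) hg (hA.mul hg.1) ?_
  filter_upwards [hb] with x hx
  rw [norm_mul, Real.norm_of_nonneg (by linarith)]
  exact mul_le_mul_of_nonneg_right hx.2 (norm_nonneg _)

lemma memLp_inv_coef {a b α₁ α₂ : ℝ} (hα : 0 < α₁) {A : ℝ → ℝ}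
    (hA : AEStronglyMeasurable A (volume.restrict (Ioo a b)))
    (hb : ∀ᵐ x ∂(volume.restrict (Ioo a b)), α₁ ≤ A x ∧ A x ≤ α₂) (p : ENNReal) :
    MemLp (fun x => (A x)⁻¹) p (volume.restrict (Ioo a b)) := by
  refine MemLp.of_bound hA.aemeasurable.inv.aestronglyMeasurable α₁⁻¹ ?_
  filter_upwards [hb] with x hx
  rw [norm_inv, Real.norm_of_nonneg (by linarith)]
  exact inv_anti₀ hα hx.1

lemma coercive {a b α₁ α₂ : ℝ} (hα : 0 < α₁) {A g : ℝ → ℝ}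
    (hA : AEStronglyMeasurable A (volume.restrict (Ioo a b)))
    (hb : ∀ᵐ x ∂(volume.restrict (Ioo a b)), α₁ ≤ A x ∧ A x ≤ α₂)
    (hg : MemLp g 2 (volume.restrict (Ioo a b))) :
    α₁ * l2Norm a b g ^ 2 ≤ ∫ x in Ioo a b, A x * g x * g x := by
  rw [l2Norm_sq, ← integral_const_mul]
  refine integral_mono_ae (hg.integrable_sq.const_mul _)
    (integrable_mul_fun (memLp_coef_mul hα hA hb hg) hg) ?_
  filter_upwards [hb] with x hx
  have := mul_le_mul_of_nonneg_right hx.1 (sq_nonneg (g x))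
  show α₁ * g x ^ 2 ≤ A x * g x * g x
  linarith

/-! ### The weak formulation -/

lemma aForm_eq {L α₁ α₂ b : ℝ} (hL : 0 < L) (hα : 0 < α₁) {A u v : ℝ → ℝ}
    (hA : AEStronglyMeasurable A (volume.restrict (Ioo 0 L)))
    (hb : ∀ᵐ x ∂(volume.restrict (Ioo 0 L)), α₁ ≤ A x ∧ A x ≤ α₂)
    (hu : IsH10 0 L u) (hv : IsH10 0 L v) :
    aForm L A b u v = (∫ x in Ioo 0 L, A x * deriv u x * deriv v x) +
      b * ∫ x in Ioo 0 L, deriv u x * v x := by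
  rw [← integral_const_mul, ← integral_add
    (integrable_mul_fun (memLp_coef_mul hα hA hb hu.memLp_deriv) hv.memLp_deriv)
    ((integrable_mul_fun hu.memLp_deriv (hv.memLp hL.le)).const_mul b)]
  refine integral_congr_ae ?_
  filter_upwards [weakDeriv_ae_eq_deriv hL.le hu.ac, weakDeriv_ae_eq_deriv hL.le hv.ac] with x h1 h2
  rw [h1, h2]
  simp; ring

/-- Test with `u` itself; only diffusion survives on the left. -/
lemma IsWeakSolution.energy_le {L α₁ α₂ b : ℝ} (hL : 0 < L) (hα : 0 < α₁) {A f u : ℝ → ℝ}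
    (hA : AEStronglyMeasurable A (volume.restrict (Ioo 0 L)))
    (hb : ∀ᵐ x ∂(volume.restrict (Ioo 0 L)), α₁ ≤ A x ∧ A x ≤ α₂)
    (hf : MemLp f 2 (volume.restrict (Ioo 0 L))) (h : IsWeakSolution L A b f u) :
    ∫ x in Ioo 0 L, A x * deriv u x * deriv u x ≤ l2Norm 0 L f * l2Norm 0 L u := by
  have hu : IsH10 0 L u := (memH10_iff_isH10 hL).1 h.1
  have h1 := h.2 u h.1
  rw [aForm_eq hL hα hA hb hu hu, hu.integral_deriv_mul_self hL.le, mul_zero, add_zero] at h1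
  rw [h1]
  exact (le_abs_self _).trans (abs_integral_mul_le hf (hu.memLp hL.le))

/-- The `L²` stability in the advection dominated regime, obtained by testing with `x u`. -/
lemma IsWeakSolution.l2Norm_le {L α₁ α₂ b : ℝ} (hL : 0 < L) (hα : 0 < α₁)
    {A f u : ℝ → ℝ} (hA : AEStronglyMeasurable A (volume.restrict (Ioo 0 L)))
    (hb : ∀ᵐ x ∂(volume.restrict (Ioo 0 L)), α₁ ≤ A x ∧ A x ≤ α₂)
    (hf : MemLp f 2 (volume.restrict (Ioo 0 L))) (hbL : α₂ ≤ |b| * L)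
    (h : IsWeakSolution L A b f u) :
    |b| * l2Norm 0 L u ≤ 12 * L * l2Norm 0 L f := by
  have hu : IsH10 0 L u := (memH10_iff_isH10 hL).1 h.1
  obtain ⟨hv, hvd⟩ := hu.id_mul hL.le
  have hen := h.energy_le hL hα hA hb hf
  have hu2 := hu.memLp hL.le
  have hAu := memLp_coef_mul hα hA hb hu.memLp_deriv
  have hxu := hv.memLp hL.le
  have htest := h.2 _ ((memH10_iff_isH10 hL).2 hv)
  rw [aForm_eq hL hα hA hb hu hv] at htest
  -- The weight `x` breaks the skew-symmetry: the advection term now controls `‖u‖²`, with a sign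
  -- that depends only on `b`.
  have hibp : ∫ x in Ioo 0 L, deriv u x * (x * u x) = -(1 / 2) * l2Norm 0 L u ^ 2 := by
    have h1 := IsH10.integral_deriv_mul hL.le hu.ac hv
    have h2 : ∫ x in Ioo 0 L, u x * deriv (fun x => x * u x) x =
        l2Norm 0 L u ^ 2 + ∫ x in Ioo 0 L, deriv u x * (x * u x) := by
      rw [l2Norm_sq, ← integral_add hu2.integrable_sq (integrable_mul_fun hu.memLp_deriv hxu)]
      refine integral_congr_ae ?_
      filter_upwards [hvd] with x hx
      rw [hx]; ring
    linarith
  have hAI : Integrable (fun x => A x * deriv u x * deriv u x) (volume.restrict (Ioo 0 L)) :=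
    integrable_mul_fun hAu hu.memLp_deriv
  have hbound : |∫ x in Ioo 0 L, A x * deriv u x * deriv (fun x => x * u x) x| ≤
      2 * L * (∫ x in Ioo 0 L, A x * deriv u x * deriv u x) + |b| / 4 * l2Norm 0 L u ^ 2 := by
    rw [l2Norm_sq, ← integral_const_mul, ← integral_const_mul, ← integral_add
      (hAI.const_mul _) (hu2.integrable_sq.const_mul _)]
    refine (abs_integral_le_integral_abs).trans (integral_mono_ae
      (integrable_mul_fun hAu hv.memLp_deriv).abs
      ((hAI.const_mul _).add (hu2.integrable_sq.const_mul _)) ?_)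
    filter_upwards [hvd, hb, ae_restrict_mem measurableSet_Ioo] with x hx hAx hxs
    rw [hx]
    set p := deriv u x
    set q := u x
    have hA0 : 0 ≤ A x := by linarith
    have hpp : 0 ≤ A x * p * p := by
      have := mul_nonneg hA0 (mul_self_nonneg p); linarith
    have e1 : x * (A x * p * p) ≤ L * (A x * p * p) :=
      mul_le_mul_of_nonneg_right hxs.2.le hpp
    have e1' : 0 ≤ x * (A x * p * p) := mul_nonneg hxs.1.le hpp
    have hAb : A x * q ^ 2 ≤ |b| * L * q ^ 2 :=
      mul_le_mul_of_nonneg_right (hAx.2.trans hbL) (sq_nonneg q)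
    -- Young's inequality from `(2 L |p| - |q|)² ≥ 0`, followed by `A ≤ α₂ ≤ |b| L`. The weight
    -- leaves `|b| / 4`, half of the coefficient `|b| / 2` available on the other side.
    have hyoung : |A x * p * q| ≤ L * (A x * p * p) + |b| / 4 * q ^ 2 := by
      have y1 : 4 * L * |A x * p * q| ≤ 4 * L * (L * (A x * p * p) + |b| / 4 * q ^ 2) := by
        have : 4 * L * |A x * p * q| ≤ A x * (4 * L ^ 2 * p ^ 2 + q ^ 2) := by
          rw [abs_mul, abs_mul, abs_of_nonneg hA0, ← sq_abs p, ← sq_abs q]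
          have := mul_nonneg hA0 (sq_nonneg (2 * L * |p| - |q|))
          nlinarith
        nlinarith
      exact le_of_mul_le_mul_left y1 (by positivity)
    have hsplit : A x * p * (q + x * p) = A x * p * q + x * (A x * p * p) := by ring
    rw [hsplit]
    refine (abs_add_le _ _).trans ?_
    rw [abs_of_nonneg e1']
    linarith
  have hfx : |loadForm L f (fun x => x * u x)| ≤ L * (l2Norm 0 L f * l2Norm 0 L u) := by
    have h1 := abs_integral_mul_le hf hxu
    have h2 : l2Norm 0 L (fun x => x * u x) ≤ L * l2Norm 0 L u := by
      refine abs_le_of_sq_le_sq' ?_ (mul_nonneg hL.le (l2Norm_nonneg _ _ _)) |>.2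
      rw [mul_pow, l2Norm_sq, l2Norm_sq, ← integral_const_mul]
      refine integral_mono_ae hxu.integrable_sq (hu2.integrable_sq.const_mul _) ?_
      filter_upwards [ae_restrict_mem measurableSet_Ioo] with x hx
      rw [mul_pow]
      exact mul_le_mul_of_nonneg_right (pow_le_pow_left₀ hx.1.le hx.2.le 2) (sq_nonneg _)
    have h3 := mul_le_mul_of_nonneg_left h2 (l2Norm_nonneg 0 L f)
    rw [loadForm]
    linarith
  set N := l2Norm 0 L u with hN
  set F := l2Norm 0 L f
  have hN0 : 0 ≤ N := l2Norm_nonneg _ _ _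
  have hF0 : 0 ≤ F := l2Norm_nonneg _ _ _
  rw [hibp] at htest
  have hb2 : |b| / 2 * N ^ 2 ≤ |∫ x in Ioo 0 L, A x * deriv u x * deriv (fun x => x * u x) x| +
      |loadForm L f (fun x => x * u x)| := by
    have e : b / 2 * N ^ 2 = (∫ x in Ioo 0 L, A x * deriv u x * deriv (fun x => x * u x) x) -
      loadForm L f (fun x => x * u x) := by linarith
    have := abs_sub (∫ x in Ioo 0 L, A x * deriv u x * deriv (fun x => x * u x) x)
      (loadForm L f (fun x => x * u x))
    rw [← e, abs_mul, abs_div, abs_of_nonneg (sq_nonneg N)] at this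
    simpa using this
  have h2L := mul_le_mul_of_nonneg_left hen (by positivity : 0 ≤ 2 * L)
  -- Absorbing `|b| / 4 * N ^ 2` leaves `|b| / 4 * N ^ 2 ≤ (2 + 1) * L * F * N`, whence the constant
  -- `12`.
  have hfin : N * (|b| * N) ≤ N * (12 * L * F) := by nlinarith
  rcases hN0.eq_or_lt with h0 | h0
  · rw [← h0, mul_zero]; positivity
  · exact le_of_mul_le_mul_left hfin h0

/-- Coercivity, the energy bound and the `L²` bound combine to `α₁ |b|² ‖u'‖² ≤ 12 L |b| ‖f‖²`.
Multiplying by `α₁ ≤ α₂` produces the square root in the statement; the `3` comes from `12 ≤ 9 * 2`.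
-/
lemma IsWeakSolution.l2Norm_deriv_le {L α₁ α₂ b : ℝ} (hL : 0 < L) (hα : 0 < α₁) (hα₂ : α₁ ≤ α₂)
    {A f u : ℝ → ℝ} (hA : AEStronglyMeasurable A (volume.restrict (Ioo 0 L)))
    (hb : ∀ᵐ x ∂(volume.restrict (Ioo 0 L)), α₁ ≤ A x ∧ A x ≤ α₂)
    (hf : MemLp f 2 (volume.restrict (Ioo 0 L))) (hbL : α₂ ≤ |b| * L)
    (h : IsWeakSolution L A b f u) :
    |b| * l2Norm 0 L (deriv u) ≤ 3 * (Real.sqrt (2 * α₂ * L * |b|) / α₁) * l2Norm 0 L f := by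
  have hu : IsH10 0 L u := (memH10_iff_isH10 hL).1 h.1
  have h1 := (coercive hα hA hb hu.memLp_deriv).trans (h.energy_le hL hα hA hb hf)
  have h2 := h.l2Norm_le hL hα hA hb hf hbL
  set F := l2Norm 0 L f
  have hF0 : 0 ≤ F := l2Norm_nonneg _ _ _
  have hα₂0 : 0 < α₂ := hα.trans_le hα₂
  refine abs_le_of_sq_le_sq' ?_ (by positivity) |>.2
  rw [mul_pow, mul_pow, mul_pow, div_pow, Real.sq_sqrt (by positivity)]
  have h3 : α₁ * (|b| ^ 2 * l2Norm 0 L (deriv u) ^ 2) ≤ 12 * L * |b| * F ^ 2 := by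
    have e1 := mul_le_mul_of_nonneg_left h1 (sq_nonneg |b|)
    have e2 := mul_le_mul_of_nonneg_left h2 (mul_nonneg (abs_nonneg b) hF0)
    nlinarith
  have h4 : α₁ * (α₁ * (|b| ^ 2 * l2Norm 0 L (deriv u) ^ 2)) ≤ α₂ * (12 * L * |b| * F ^ 2) :=
    mul_le_mul hα₂ h3 (by positivity) hα₂0.le
  have h5 : |b| ^ 2 * l2Norm 0 L (deriv u) ^ 2 ≤ α₂ * (12 * L * |b| * F ^ 2) / α₁ ^ 2 := by
    rw [le_div_iff₀ (by positivity)]; linarith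
  refine h5.trans ?_
  rw [mul_div_assoc', div_mul_eq_mul_div]
  refine div_le_div_of_nonneg_right ?_ (by positivity)
  have : 0 ≤ α₂ * L * |b| * F ^ 2 := by positivity
  linarith


/-! ### Gluing -/

lemma memLp_deriv_iff_intervalIntegrable {a b : ℝ} (hab : a ≤ b) (u : ℝ → ℝ) :
    MemLp (deriv u) 2 (volume.restrict (Ioo a b)) ↔
      IntervalIntegrable (fun x => deriv u x ^ 2) volume a b := by
  rw [memLp_two_iff_integrable_sq (measurable_deriv u).aestronglyMeasurable,
    intervalIntegrable_iff_integrable_Ioo hab]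

lemma memLp_deriv_trans {a b c : ℝ} (hab : a ≤ b) (hbc : b ≤ c) {u : ℝ → ℝ}
    (h₁ : MemLp (deriv u) 2 (volume.restrict (Ioo a b)))
    (h₂ : MemLp (deriv u) 2 (volume.restrict (Ioo b c))) :
    MemLp (deriv u) 2 (volume.restrict (Ioo a c)) := by
  rw [memLp_deriv_iff_intervalIntegrable (hab.trans hbc)]
  exact ((memLp_deriv_iff_intervalIntegrable hab u).1 h₁).trans
    ((memLp_deriv_iff_intervalIntegrable hbc u).1 h₂)

/-- On `[a, c]`, `u` equals `u a` plus the primitive of its derivative, which is integrable on both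
pieces; primitives of integrable functions are absolutely continuous. -/
lemma AbsolutelyContinuousOnInterval.trans {a b c : ℝ} (hab : a ≤ b) (hbc : b ≤ c) {u : ℝ → ℝ}
    (h₁ : AbsolutelyContinuousOnInterval u a b) (h₂ : AbsolutelyContinuousOnInterval u b c) :
    AbsolutelyContinuousOnInterval u a c := by
  have hi := h₁.intervalIntegrable_deriv.trans h₂.intervalIntegrable_deriv
  refine absolutelyContinuousOnInterval_congr (u := fun x => (∫ t in a..x, deriv u t) + u a)
    ((hi.absolutelyContinuousOnInterval_intervalIntegral left_mem_uIcc).add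
      (contDiff_const (c := u a)).contDiffOn.absolutelyContinuousOnInterval) ?_
  intro x hx
  rw [uIcc_of_le (hab.trans hbc)] at hx
  simp only
  rcases le_total x b with h | h
  · rw [(h₁.mono (by rw [uIcc_of_le hab, uIcc_of_le hx.1]
                     exact Icc_subset_Icc_right h)).integral_deriv_eq_sub]
    ring
  · have h₂' := h₂.mono (c := b) (d := x) (by
      rw [uIcc_of_le hbc, uIcc_of_le h]; exact Icc_subset_Icc_right hx.2)
    rw [← intervalIntegral.integral_add_adjacent_intervals h₁.intervalIntegrable_deriv
      h₂'.intervalIntegrable_deriv, h₁.integral_deriv_eq_sub, h₂'.integral_deriv_eq_sub]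
    ring

/-! ### The mesh -/

namespace Mesh

variable {L : ℝ} (T : Mesh L)

lemma node_le {j k : ℕ} (hjk : j ≤ k) (hk : k ≤ T.n) : T.node j ≤ T.node k := by
  induction k, hjk using Nat.le_induction with
  | base => exact le_rfl
  | succ k _ ih => exact (ih (by omega)).trans (T.node_lt k (by omega)).le

lemma node_nonneg {k : ℕ} (hk : k ≤ T.n) : 0 ≤ T.node k := by
  have := T.node_le (Nat.zero_le k) hk
  rwa [T.node_zero] at this

lemma node_le_length {k : ℕ} (hk : k ≤ T.n) : T.node k ≤ L := by
  have := T.node_le hk le_rfl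
  rwa [T.node_n] at this

lemma element_subset {k : ℕ} (hk : k < T.n) :
    Ioo (T.node k) (T.node (k + 1)) ⊆ Ioo 0 L :=
  Ioo_subset_Ioo (T.node_nonneg hk.le) (T.node_le_length hk)

lemma restrict_element_le {k : ℕ} (hk : k < T.n) :
    volume.restrict (Ioo (T.node k) (T.node (k + 1))) ≤ volume.restrict (Ioo 0 L) :=
  Measure.restrict_mono (T.element_subset hk) le_rfl

lemma ae_element {k : ℕ} (hk : k < T.n) {p : ℝ → Prop}
    (h : ∀ᵐ x ∂(volume.restrict (Ioo 0 L)), p x) :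
    ∀ᵐ x ∂(volume.restrict (Ioo (T.node k) (T.node (k + 1)))), p x :=
  (Measure.absolutelyContinuous_of_le (T.restrict_element_le hk)).ae_le h

lemma absolutelyContinuous_element {k : ℕ} (hL : 0 ≤ L) (hk : k < T.n) {u : ℝ → ℝ}
    (hu : AbsolutelyContinuousOnInterval u 0 L) :
    AbsolutelyContinuousOnInterval u (T.node k) (T.node (k + 1)) :=
  hu.mono (by
    rw [uIcc_of_le hL, uIcc_of_le (T.node_lt k hk).le]
    exact Icc_subset_Icc (T.node_nonneg hk.le) (T.node_le_length hk))

lemma length_le_size {k : ℕ} (hk : k < T.n) : T.node (k + 1) - T.node k ≤ T.size :=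
  le_ciSup (f := fun k : Fin T.n => T.node ((k : ℕ) + 1) - T.node (k : ℕ))
    (Set.finite_range _).bddAbove ⟨k, hk⟩

lemma sum_integral_eq (hL : 0 ≤ L) {g : ℝ → ℝ} (hg : Integrable g (volume.restrict (Ioo 0 L))) :
    ∑ k ∈ Finset.range T.n, ∫ x in Ioo (T.node k) (T.node (k + 1)), g x =
      ∫ x in Ioo 0 L, g x := by
  have h := intervalIntegral.sum_integral_adjacent_intervals (f := g) (μ := volume) (a := T.node)
    (n := T.n) (fun k hk => (intervalIntegrable_iff_integrable_Ioo (T.node_lt k hk).le g).2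
      (hg.mono_measure (T.restrict_element_le hk)))
  rw [T.node_zero, T.node_n, intervalIntegral_eq_setIntegral_Ioo hL] at h
  rw [← h]
  refine Finset.sum_congr rfl fun k hk => ?_
  rw [intervalIntegral_eq_setIntegral_Ioo (T.node_lt k (Finset.mem_range.1 hk)).le]

lemma size_nonneg (hL : 0 < L) : 0 ≤ T.size := by
  have hn : 0 < T.n := by
    rcases Nat.eq_zero_or_pos T.n with h | h
    · have := T.node_n
      rw [h, T.node_zero] at this
      linarith
    · exact h
  linarith [T.length_le_size hn, T.node_lt 0 hn]

lemma hat_node {i j : ℕ} (hi : i + 1 < T.n) (hj : j ≤ T.n) :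
    T.hat i (T.node j) = if j = i + 1 then 1 else 0 := by
  have h1 : 0 < T.node (i + 1) - T.node i := sub_pos.2 (T.node_lt i (by omega))
  have h2 : 0 < T.node (i + 2) - T.node (i + 1) := sub_pos.2 (T.node_lt (i + 1) hi)
  unfold hat
  split_ifs with h
  · rw [h, div_self h1.ne', div_self h2.ne']; simp
  · refine max_eq_left ?_
    rcases Nat.lt_or_ge i j with h' | h'
    · exact (min_le_right _ _).trans (div_nonpos_of_nonpos_of_nonneg
        (sub_nonpos.2 (T.node_le (by omega) hj)) h2.le)
    · exact (min_le_left _ _).trans (div_nonpos_of_nonpos_of_nonneg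
        (sub_nonpos.2 (T.node_le h' (by omega))) h1.le)

/-- Poincaré's inequality for functions that vanish at the nodes. -/
lemma l2Norm_le_size_mul (hL : 0 < L) {e : ℝ → ℝ} (he : IsH10 0 L e)
    (h0 : ∀ k ≤ T.n, e (T.node k) = 0) :
    l2Norm 0 L e ≤ T.size * l2Norm 0 L (deriv e) := by
  have hH := T.size_nonneg hL
  refine abs_le_of_sq_le_sq' ?_ (mul_nonneg hH (l2Norm_nonneg _ _ _)) |>.2
  rw [mul_pow, l2Norm_sq, l2Norm_sq, ← T.sum_integral_eq hL.le (he.memLp hL.le).integrable_sq,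
    ← T.sum_integral_eq hL.le he.memLp_deriv.integrable_sq, Finset.mul_sum]
  refine Finset.sum_le_sum fun k hk => ?_
  have hk := Finset.mem_range.1 hk
  have hlt := T.node_lt k hk
  refine (integral_sq_le_of_left_eq_zero hlt.le (T.absolutelyContinuous_element hL.le hk he.ac)
    (he.memLp_deriv.mono_measure (T.restrict_element_le hk)) (h0 k hk.le)).trans ?_
  exact mul_le_mul_of_nonneg_right (pow_le_pow_left₀ (by linarith) (T.length_le_size hk) 2)
    (integral_nonneg fun _ => sq_nonneg _)

end Mesh

/-! ### The multiscale space -/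

/-- `v` is in `H¹₀(0, L)`, and its flux `A v'` is constant on each element. -/
structure IsFluxConst {L : ℝ} (T : Mesh L) (A v : ℝ → ℝ) : Prop where
  isH10 : IsH10 0 L v
  flux : ∀ k < T.n, ∃ c, ∀ᵐ x ∂(volume.restrict (Ioo (T.node k) (T.node (k + 1)))),
    A x * deriv v x = c

lemma setIntegral_deriv_eq_sub {a b : ℝ} (hab : a ≤ b) {u : ℝ → ℝ}
    (hu : AbsolutelyContinuousOnInterval u a b) : ∫ x in Ioo a b, deriv u x = u b - u a := by
  rw [← intervalIntegral_eq_setIntegral_Ioo hab, hu.integral_deriv_eq_sub]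

/-- A function of constant flux is `A`-orthogonal to the functions that vanish at the nodes. -/
lemma IsFluxConst.integral_eq_zero {L α₁ α₂ : ℝ} (hL : 0 < L) (hα : 0 < α₁) {T : Mesh L}
    {A v e : ℝ → ℝ} (hA : AEStronglyMeasurable A (volume.restrict (Ioo 0 L)))
    (hb : ∀ᵐ x ∂(volume.restrict (Ioo 0 L)), α₁ ≤ A x ∧ A x ≤ α₂)
    (hv : IsFluxConst T A v) (he : IsH10 0 L e) (h0 : ∀ k ≤ T.n, e (T.node k) = 0) :
    ∫ x in Ioo 0 L, A x * deriv v x * deriv e x = 0 := by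
  rw [← T.sum_integral_eq hL.le
    (integrable_mul_fun (memLp_coef_mul hα hA hb hv.isH10.memLp_deriv) he.memLp_deriv)]
  refine Finset.sum_eq_zero fun k hk => ?_
  have hk := Finset.mem_range.1 hk
  obtain ⟨c, hc⟩ := hv.flux k hk
  have : ∫ x in Ioo (T.node k) (T.node (k + 1)), A x * deriv v x * deriv e x =
      ∫ x in Ioo (T.node k) (T.node (k + 1)), c * deriv e x := by
    refine integral_congr_ae ?_
    filter_upwards [hc] with x hx
    rw [hx]
  rw [this, integral_const_mul, setIntegral_deriv_eq_sub (T.node_lt k hk).le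
    (T.absolutelyContinuous_element hL.le hk he.ac), h0 k hk.le, h0 (k + 1) hk]
  simp

/-- The primitive of the flux minus its mean `m` vanishes at both end points, so it is an admissible
test function. Testing with it gives `∫ (A ψ' - m)² = 0`. -/
lemma IsLocalSolution.flux_const {a b α₁ α₂ : ℝ} (hab : a < b) (hα : 0 < α₁) {A φ ψ : ℝ → ℝ}
    (hA : AEStronglyMeasurable A (volume.restrict (Ioo a b)))
    (hb : ∀ᵐ x ∂(volume.restrict (Ioo a b)), α₁ ≤ A x ∧ A x ≤ α₂)
    (h : IsLocalSolution a b A φ ψ) :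
    ∃ c, ∀ᵐ x ∂(volume.restrict (Ioo a b)), A x * deriv ψ x = c := by
  obtain ⟨hψ, -, -, hw⟩ := h
  have hψ' := hψ.absolutelyContinuous hab
  have hF := memLp_coef_mul hα hA hb hψ'.2
  set m := (∫ x in Ioo a b, A x * deriv ψ x) / (b - a) with hm
  have hr : MemLp (fun x => A x * deriv ψ x - m) 2 (volume.restrict (Ioo a b)) :=
    hF.sub (memLp_const m)
  have hri : Integrable (fun x => A x * deriv ψ x - m) (volume.restrict (Ioo a b)) :=
    hr.integrable (by norm_num)
  have hr0 : ∫ x in Ioo a b, (A x * deriv ψ x - m) = 0 := by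
    rw [integral_sub (hF.integrable (by norm_num)) (integrable_const m)]
    have : b - a ≠ 0 := (sub_pos.2 hab).ne'
    simp [hab.le, hm]
    field_simp
    simp
  set v : ℝ → ℝ := fun x => ∫ t in a..x, (A t * deriv ψ t - m) with hv
  have hvac : AbsolutelyContinuousOnInterval v a b := primitive_absolutelyContinuous hab.le hri
  have hvd := deriv_primitive_ae_eq hab.le hri
  have hv10 : IsH10 a b v := ⟨hvac, (memLp_congr_ae hvd).2 hr, by simp [hv], by
    rw [hv]; simp only; rw [intervalIntegral_eq_setIntegral_Ioo hab.le, hr0]⟩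
  have key := hw v ((memH10_iff_isH10 hab).2 hv10)
  have e1 : ∫ x in Ioo a b, A x * weakDeriv a b ψ x * weakDeriv a b v x =
      ∫ x in Ioo a b, ((A x * deriv ψ x - m) ^ 2 + m * (A x * deriv ψ x - m)) := by
    refine integral_congr_ae ?_
    filter_upwards [weakDeriv_ae_eq_deriv hab.le hψ'.1, weakDeriv_ae_eq_deriv hab.le hvac, hvd]
      with x h1 h2 h3
    rw [h1, h2, h3]; ring
  rw [e1, integral_add hr.integrable_sq (hri.const_mul m), integral_const_mul, hr0, mul_zero,
    add_zero, integral_eq_zero_iff_of_nonneg (fun _ => sq_nonneg _) hr.integrable_sq] at key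
  refine ⟨m, ?_⟩
  filter_upwards [key] with x hx
  have : (A x * deriv ψ x - m) ^ 2 = 0 := hx
  exact sub_eq_zero.1 (pow_eq_zero_iff (by norm_num) |>.1 this)

lemma IsMultiscaleBasis.isFluxConst {L α₁ α₂ : ℝ} (hα : 0 < α₁) {T : Mesh L}
    {A ψ : ℝ → ℝ} (hA : AEStronglyMeasurable A (volume.restrict (Ioo 0 L)))
    (hb : ∀ᵐ x ∂(volume.restrict (Ioo 0 L)), α₁ ≤ A x ∧ A x ≤ α₂) {i : ℕ} (hi : i + 1 < T.n)
    (h : IsMultiscaleBasis T A i ψ) : IsFluxConst T A ψ := by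
  -- The local problems only give regularity on each element; gluing element by element makes it
  -- global.
  have hglue : ∀ k ≤ T.n, AbsolutelyContinuousOnInterval ψ 0 (T.node k) ∧
      MemLp (deriv ψ) 2 (volume.restrict (Ioo 0 (T.node k))) := by
    intro k
    induction k with
    | zero =>
      intro _
      rw [T.node_zero]
      refine ⟨LipschitzOnWith.absolutelyContinuousOnInterval (K := 0) ?_, by simp⟩
      rw [uIcc_self]
      exact LipschitzOnWith.of_dist_le_mul fun x hx y hy => by
        rw [mem_singleton_iff.1 hx, mem_singleton_iff.1 hy]; simp
    | succ k ih =>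
      intro hk
      obtain ⟨h1, h2⟩ := ih (by omega)
      obtain ⟨h3, h4⟩ := (h k (by omega)).1.absolutelyContinuous (T.node_lt k (by omega))
      have hk0 := T.node_nonneg (k := k) (by omega)
      have hk1 := (T.node_lt k (by omega)).le
      exact ⟨AbsolutelyContinuousOnInterval.trans hk0 hk1 h1 h3, memLp_deriv_trans hk0 hk1 h2 h4⟩
  obtain ⟨h1, h2⟩ := hglue T.n le_rfl
  rw [T.node_n] at h1 h2
  refine ⟨⟨h1, h2, ?_, ?_⟩, fun k hk => ?_⟩
  · have := (h 0 (by omega)).2.1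
    rwa [T.hat_node hi (by omega), if_neg (by omega), T.node_zero] at this
  · have := (h (T.n - 1) (by omega)).2.2.1
    rwa [T.hat_node hi (by omega), if_neg (by omega), Nat.sub_add_cancel (by omega),
      T.node_n] at this
  · exact (h k hk).flux_const (T.node_lt k hk) hα (hA.mono_measure (T.restrict_element_le hk))
      (T.ae_element hk hb)

lemma isFluxConst_of_mem_msSpace {L α₁ α₂ : ℝ} (hL : 0 ≤ L) (hα : 0 < α₁) {T : Mesh L}
    {A v : ℝ → ℝ} (hA : AEStronglyMeasurable A (volume.restrict (Ioo 0 L)))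
    (hb : ∀ᵐ x ∂(volume.restrict (Ioo 0 L)), α₁ ≤ A x ∧ A x ≤ α₂) (hv : v ∈ msSpace T A) :
    IsFluxConst T A v := by
  induction hv using Submodule.span_induction with
  | mem ψ h =>
    obtain ⟨i, hi, hψ⟩ := h
    exact hψ.isFluxConst hα hA hb hi
  | zero =>
    have hd : deriv (0 : ℝ → ℝ) = 0 := by ext x; exact deriv_const x 0
    exact ⟨⟨(contDiff_const (c := (0 : ℝ))).contDiffOn.absolutelyContinuousOnInterval,
      by rw [hd]; exact MemLp.zero, rfl, rfl⟩, fun k _ => ⟨0, by simp [hd]⟩⟩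
  | add u w _ _ hu hw =>
    have hd := deriv_add_ae_eq hL hu.isH10.ac hw.isH10.ac
    refine ⟨⟨hu.isH10.ac.add hw.isH10.ac, (memLp_congr_ae hd).2
      (hu.isH10.memLp_deriv.add hw.isH10.memLp_deriv), by simp [hu.isH10.left, hw.isH10.left],
      by simp [hu.isH10.right, hw.isH10.right]⟩, fun k hk => ?_⟩
    obtain ⟨c, hc⟩ := hu.flux k hk
    obtain ⟨d, hd'⟩ := hw.flux k hk
    refine ⟨c + d, ?_⟩
    filter_upwards [hc, hd', T.ae_element hk hd] with x h1 h2 h3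
    rw [h3, mul_add, h1, h2]
  | smul r u _ hu =>
    have hd : deriv (r • u) = fun x => r * deriv u x := by
      ext x; simp [deriv_const_smul_field]
    refine ⟨⟨hu.isH10.ac.const_smul r, by rw [hd]; exact hu.isH10.memLp_deriv.const_mul r,
      by simp [hu.isH10.left], by simp [hu.isH10.right]⟩, fun k hk => ?_⟩
    obtain ⟨c, hc⟩ := hu.flux k hk
    refine ⟨r * c, ?_⟩
    filter_upwards [hc] with x h1
    rw [hd, ← h1]; ring

/-- The element-wise solution of `-(A ψ')' = 0` with given nodal values. -/
lemma exists_isLocalSolution {L α₁ α₂ : ℝ} (hL : 0 < L) (hα : 0 < α₁) (T : Mesh L)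
    {A : ℝ → ℝ} (hA : AEStronglyMeasurable A (volume.restrict (Ioo 0 L)))
    (hb : ∀ᵐ x ∂(volume.restrict (Ioo 0 L)), α₁ ≤ A x ∧ A x ≤ α₂) (φ : ℝ → ℝ) :
    ∃ ψ : ℝ → ℝ, ∀ k < T.n, IsLocalSolution (T.node k) (T.node (k + 1)) A φ ψ := by
  -- Constant flux means `ψ' = c k / A` on the element; this value of `c k` produces the prescribed
  -- increment between its end points.
  set c : ℕ → ℝ := fun k => (φ (T.node (k + 1)) - φ (T.node k)) /
    ∫ x in Ioo (T.node k) (T.node (k + 1)), (A x)⁻¹ with hc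
  set g : ℝ → ℝ := fun x => ∑ k ∈ Finset.range T.n,
    (Ioo (T.node k) (T.node (k + 1))).indicator (fun y => c k * (A y)⁻¹) x with hg
  have hinv := memLp_inv_coef hα hA hb 2
  have hg2 : MemLp g 2 (volume.restrict (Ioo 0 L)) :=
    memLp_finsetSum _ fun k _ => (hinv.const_mul (c k)).indicator measurableSet_Ioo
  have hgi : Integrable g (volume.restrict (Ioo 0 L)) := hg2.integrable (by norm_num)
  have hgk : ∀ k < T.n, EqOn g (fun y => c k * (A y)⁻¹) (Ioo (T.node k) (T.node (k + 1))) := by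
    intro k hk x hx
    rw [hg]
    simp only
    rw [Finset.sum_eq_single k]
    · rw [indicator_of_mem hx]
    · intro j hj hjk
      rw [Finset.mem_range] at hj
      refine indicator_of_notMem (fun hxj => ?_) _
      rcases Nat.lt_or_gt_of_ne hjk with h | h
      · linarith [T.node_le (j := j + 1) (k := k) h hk.le, hxj.2, hx.1]
      · linarith [T.node_le (j := k + 1) (k := j) h hj.le, hxj.1, hx.2]
    · intro h; exact absurd (Finset.mem_range.2 hk) h
  set ψ : ℝ → ℝ := fun x => (∫ t in (0 : ℝ)..x, g t) + φ (T.node 0) with hψ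
  have hψd : deriv ψ =ᵐ[volume.restrict (Ioo 0 L)] g := by
    filter_upwards [deriv_primitive_ae_eq hL.le hgi] with x hx
    rw [← hx, hψ]; simp
  have hψac : AbsolutelyContinuousOnInterval ψ 0 L :=
    (primitive_absolutelyContinuous hL.le hgi).add
      (contDiff_const (c := φ (T.node 0))).contDiffOn.absolutelyContinuousOnInterval
  have hflux : ∀ k < T.n, ∀ᵐ x ∂(volume.restrict (Ioo (T.node k) (T.node (k + 1)))),
      deriv ψ x = c k * (A x)⁻¹ := by
    intro k hk
    filter_upwards [T.ae_element hk hψd, ae_restrict_mem measurableSet_Ioo] with x h1 h2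
    rw [h1, hgk k hk h2]
  have hpos : ∀ k < T.n, 0 < ∫ x in Ioo (T.node k) (T.node (k + 1)), (A x)⁻¹ := by
    intro k hk
    have hlt := T.node_lt k hk
    have hbk := T.ae_element hk hb
    -- Positivity of `α₂` follows from the bounds on `A` at one point, which exists because the
    -- element has positive measure.
    have hα₂ : 0 < α₂ := by
      have : Filter.NeBot (ae (volume.restrict (Ioo (T.node k) (T.node (k + 1))))) := by
        rw [ae_neBot, Ne, Measure.restrict_eq_zero]; simp [hlt]
      obtain ⟨x, hx⟩ := hbk.exists
      linarith [hx.1, hx.2]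
    calc (0 : ℝ) < ∫ x in Ioo (T.node k) (T.node (k + 1)), α₂⁻¹ := by
          simp [hlt.le, hlt, hα₂]
      _ ≤ _ := by
          refine integral_mono_ae (integrable_const _)
            ((hinv.mono_measure (T.restrict_element_le hk)).integrable (by norm_num)) ?_
          filter_upwards [hbk] with x hx
          exact inv_anti₀ (by linarith) hx.2
  have hnode : ∀ k ≤ T.n, ψ (T.node k) = φ (T.node k) := by
    intro k
    induction k with
    | zero => intro _; rw [hψ]; simp [T.node_zero]
    | succ k ih =>
      intro hk
      have h1 := setIntegral_deriv_eq_sub (T.node_lt k hk).le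
        (T.absolutelyContinuous_element hL.le hk hψac)
      rw [integral_congr_ae (hflux k hk), integral_const_mul, hc] at h1
      simp only at h1
      rw [div_mul_cancel₀ _ (hpos k hk).ne', ih (by omega)] at h1
      linarith
  refine ⟨ψ, fun k hk => ?_⟩
  have hlt := T.node_lt k hk
  have hack := T.absolutelyContinuous_element hL.le hk hψac
  refine ⟨(memH1_iff hlt).2 ⟨hack, ?_⟩, hnode k hk.le, hnode (k + 1) hk, fun v hv => ?_⟩
  · exact ((memLp_congr_ae hψd).2 hg2).mono_measure (T.restrict_element_le hk)
  · rw [memH10_iff_isH10 hlt] at hv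
    have : ∫ x in Ioo (T.node k) (T.node (k + 1)),
        A x * weakDeriv (T.node k) (T.node (k + 1)) ψ x *
          weakDeriv (T.node k) (T.node (k + 1)) v x =
        ∫ x in Ioo (T.node k) (T.node (k + 1)), c k * deriv v x := by
      refine integral_congr_ae ?_
      filter_upwards [weakDeriv_ae_eq_deriv hlt.le hack, weakDeriv_ae_eq_deriv hlt.le hv.ac,
        hflux k hk, T.ae_element hk hb] with x h1 h2 h3 h4
      have : A x ≠ 0 := by linarith [h4.1] |> fun h : 0 < A x => h.ne'
      rw [h1, h2, h3]
      field_simp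
    rw [this, integral_const_mul, setIntegral_deriv_eq_sub hlt.le hv.ac, hv.left, hv.right]
    simp

/-- The nodal interpolation operator onto the multiscale space. -/
lemma exists_interpolant {L α₁ α₂ : ℝ} (hL : 0 < L) (hα : 0 < α₁) (T : Mesh L)
    {A u : ℝ → ℝ} (hA : AEStronglyMeasurable A (volume.restrict (Ioo 0 L)))
    (hb : ∀ᵐ x ∂(volume.restrict (Ioo 0 L)), α₁ ≤ A x ∧ A x ≤ α₂) (h0 : u 0 = 0) (h1 : u L = 0) :
    ∃ v ∈ msSpace T A, ∀ k ≤ T.n, v (T.node k) = u (T.node k) := by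
  choose ψ hψ using fun i => exists_isLocalSolution hL hα T hA hb (T.hat i)
  have hval : ∀ i, i + 1 < T.n → ∀ k ≤ T.n, ψ i (T.node k) = if k = i + 1 then 1 else 0 := by
    intro i hi k hk
    rw [← T.hat_node hi hk]
    -- The last node is the left end of no element, so its value is read from the right end of the
    -- last one.
    rcases Nat.lt_or_ge k T.n with h | h
    · exact (hψ i k h).2.1
    · have := (hψ i (T.n - 1) (by omega)).2.2.1
      rwa [Nat.sub_add_cancel (by omega), ← le_antisymm hk h] at this
  refine ⟨∑ i ∈ Finset.range (T.n - 1), u (T.node (i + 1)) • ψ i,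
    Submodule.sum_mem _ fun i hi => Submodule.smul_mem _ _ (Submodule.subset_span
      ⟨i, by rw [Finset.mem_range] at hi; omega, hψ i⟩), fun k hk => ?_⟩
  simp only [Finset.sum_apply, Pi.smul_apply, smul_eq_mul]
  rw [Finset.sum_congr rfl fun i hi => by
    rw [hval i (by rw [Finset.mem_range] at hi; omega) k hk]]
  rcases Nat.eq_zero_or_pos k with rfl | hk0
  · rw [T.node_zero, h0]
    exact Finset.sum_eq_zero fun i _ => by rw [if_neg (by omega), mul_zero]
  rcases hk.eq_or_lt with rfl | hkn
  · rw [T.node_n, h1]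
    exact Finset.sum_eq_zero fun i hi => by
      rw [Finset.mem_range] at hi
      rw [if_neg (by omega), mul_zero]
  -- Index shift: the function attached to node `k` is `ψ (k - 1)`.
  · rw [Finset.sum_eq_single (k - 1)]
    · rw [if_pos (by omega), mul_one, Nat.sub_add_cancel hk0]
    · intro i _ hi
      rw [if_neg (by omega), mul_zero]
    · intro h
      exact absurd (Finset.mem_range.2 (by omega)) h


/-! ### The discrete problem -/

/-- The flux is almost everywhere constant on each element, so its weak derivative there is zero and
only the streamline diffusion remains. -/
lemma aStab_eq {L b t : ℝ} (hL : 0 < L) {T : Mesh L} {A u v : ℝ → ℝ}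
    (hu : IsFluxConst T A u) (hv : IsH10 0 L v) :
    aStab T A b (fun _ => t) u v =
      t * b ^ 2 * ∫ x in Ioo 0 L, deriv u x * deriv v x := by
  rw [← T.sum_integral_eq hL.le (integrable_mul_fun hu.isH10.memLp_deriv hv.memLp_deriv),
    Finset.mul_sum]
  refine Finset.sum_congr rfl fun k hk => ?_
  have hk := Finset.mem_range.1 hk
  have hlt := T.node_lt k hk
  rw [← integral_const_mul]
  obtain ⟨c, hc⟩ := hu.flux k hk
  have hu' := T.ae_element hk (weakDeriv_ae_eq_deriv hL.le hu.isH10.ac)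
  have hv' := T.ae_element hk (weakDeriv_ae_eq_deriv hL.le hv.ac)
  have hflux : (fun y => A y * weakDeriv 0 L u y)
      =ᵐ[volume.restrict (Ioo (T.node k) (T.node (k + 1)))] fun _ => c := by
    filter_upwards [hc, hu'] with x h1 h2
    rw [h2, h1]
  have hw : HasWeakDeriv (T.node k) (T.node (k + 1)) (fun y => A y * weakDeriv 0 L u y)
      (fun _ => 0) := by
    have h0 := hasWeakDeriv_deriv hlt.le (u := fun _ => c)
      (contDiff_const (c := c)).contDiffOn.absolutelyContinuousOnInterval
    simp only [deriv_const'] at h0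
    refine ⟨IntegrableOn.locallyIntegrableOn ((integrable_congr hflux).2 (integrable_const c)),
      h0.2.1, fun φ h1 h2 h3 => ?_⟩
    rw [← h0.2.2 φ h1 h2 h3]
    refine integral_congr_ae ?_
    filter_upwards [hflux] with x hx
    rw [hx]
  refine integral_congr_ae ?_
  filter_upwards [hu', hv', hw.weakDeriv_ae_eq] with x h1 h2 h3
  rw [h1, h2, h3]; ring

lemma loadStab_eq {L b t : ℝ} (hL : 0 < L) {T : Mesh L} {f v : ℝ → ℝ}
    (hf : MemLp f 2 (volume.restrict (Ioo 0 L))) (hv : IsH10 0 L v) :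
    loadStab T b (fun _ => t) f v = t * b * ∫ x in Ioo 0 L, f x * deriv v x := by
  rw [← T.sum_integral_eq hL.le (integrable_mul_fun hf hv.memLp_deriv), Finset.mul_sum]
  refine Finset.sum_congr rfl fun k hk => ?_
  rw [← integral_const_mul]
  refine integral_congr_ae ?_
  filter_upwards [T.ae_element (Finset.mem_range.1 hk) (weakDeriv_ae_eq_deriv hL.le hv.ac)]
    with x h1
  rw [h1]; ring

/-- The interpolation error. -/
lemma interpolation_error {L α₁ α₂ b : ℝ} (hL : 0 < L) (hα : 0 < α₁) {T : Mesh L}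
    {A f u v : ℝ → ℝ} (hA : AEStronglyMeasurable A (volume.restrict (Ioo 0 L)))
    (hb : ∀ᵐ x ∂(volume.restrict (Ioo 0 L)), α₁ ≤ A x ∧ A x ≤ α₂)
    (hf : MemLp f 2 (volume.restrict (Ioo 0 L))) (h : IsWeakSolution L A b f u)
    (hv : IsFluxConst T A v) (hnode : ∀ k ≤ T.n, v (T.node k) = u (T.node k)) :
    α₁ * l2Norm 0 L (deriv (u - v)) ≤
      T.size * l2Norm 0 L (fun x => f x - b * deriv u x) := by
  have hu : IsH10 0 L u := (memH10_iff_isH10 hL).1 h.1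
  have he : IsH10 0 L (u - v) := hu.sub hL.le hv.isH10
  have h0 : ∀ k ≤ T.n, (u - v) (T.node k) = 0 := fun k hk => by simp [hnode k hk]
  have hP := T.l2Norm_le_size_mul hL he h0
  have horth := hv.integral_eq_zero hL hα hA hb he h0
  have hco := coercive hα hA hb he.memLp_deriv
  have hr : MemLp (fun x => f x - b * deriv u x) 2 (volume.restrict (Ioo 0 L)) :=
    hf.sub (hu.memLp_deriv.const_mul b)
  have htest := h.2 _ ((memH10_iff_isH10 hL).2 he)
  rw [aForm_eq hL hα hA hb hu he, loadForm] at htest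
  have e1 : ∫ x in Ioo 0 L, A x * deriv (u - v) x * deriv (u - v) x =
      (∫ x in Ioo 0 L, A x * deriv u x * deriv (u - v) x) -
        ∫ x in Ioo 0 L, A x * deriv v x * deriv (u - v) x := by
    rw [← integral_sub (integrable_mul_fun (memLp_coef_mul hα hA hb hu.memLp_deriv) he.memLp_deriv)
      (integrable_mul_fun (memLp_coef_mul hα hA hb hv.isH10.memLp_deriv) he.memLp_deriv)]
    refine integral_congr_ae ?_
    filter_upwards [deriv_sub_ae_eq hL.le hu.ac hv.isH10.ac] with x hx
    rw [hx]; ring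
  have e2 : ∫ x in Ioo 0 L, (f x - b * deriv u x) * (u - v) x =
      (∫ x in Ioo 0 L, f x * (u - v) x) - b * ∫ x in Ioo 0 L, deriv u x * (u - v) x := by
    rw [← integral_const_mul, ← integral_sub (integrable_mul_fun hf (he.memLp hL.le))
      ((integrable_mul_fun hu.memLp_deriv (he.memLp hL.le)).const_mul b)]
    congr 1; ext x; ring
  have hcs := (le_abs_self _).trans (abs_integral_mul_le hr (he.memLp hL.le))
  set N := l2Norm 0 L (deriv (u - v))
  set R := l2Norm 0 L (fun x => f x - b * deriv u x)
  have hN0 : 0 ≤ N := l2Norm_nonneg _ _ _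
  have hR0 : 0 ≤ R := l2Norm_nonneg _ _ _
  have hfin : N * (α₁ * N) ≤ N * (T.size * R) := by
    have := mul_le_mul_of_nonneg_left hP hR0
    nlinarith
  rcases hN0.eq_or_lt with h' | h'
  · rw [← h', mul_zero]; exact mul_nonneg (T.size_nonneg hL) hR0
  · exact le_of_mul_le_mul_left hfin h'

/-- The distance of the discrete solution to the interpolant. -/
lemma discrete_error {L α₁ α₂ b : ℝ} (hL : 0 < L) (hα : 0 < α₁) (hb0 : b ≠ 0) {T : Mesh L}
    (hH : 0 < T.size) {A f u v uH : ℝ → ℝ}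
    (hA : AEStronglyMeasurable A (volume.restrict (Ioo 0 L)))
    (hb : ∀ᵐ x ∂(volume.restrict (Ioo 0 L)), α₁ ≤ A x ∧ A x ≤ α₂)
    (hf : MemLp f 2 (volume.restrict (Ioo 0 L))) (h : IsWeakSolution L A b f u)
    (hv : v ∈ msSpace T A) (hnode : ∀ k ≤ T.n, v (T.node k) = u (T.node k))
    (hs : IsStabMsFEMSolution T A b (fun _ => T.size / (2 * |b|)) f uH) :
    |b| * l2Norm 0 L (deriv (uH - v)) ≤
      3 * (|b| * l2Norm 0 L (deriv (u - v))) + l2Norm 0 L (fun x => f x - b * deriv u x) := by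
  have hu : IsH10 0 L u := (memH10_iff_isH10 hL).1 h.1
  have hvF := isFluxConst_of_mem_msSpace hL.le hα hA hb hv
  have huHF := isFluxConst_of_mem_msSpace hL.le hα hA hb hs.1
  have hwm : uH - v ∈ msSpace T A := Submodule.sub_mem _ hs.1 hv
  have hwF := isFluxConst_of_mem_msSpace hL.le hα hA hb hwm
  have hw := hwF.isH10
  have he : IsH10 0 L (u - v) := hu.sub hL.le hvF.isH10
  have h0 : ∀ k ≤ T.n, (u - v) (T.node k) = 0 := fun k hk => by simp [hnode k hk]
  have hP := T.l2Norm_le_size_mul hL he h0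
  have horth := hwF.integral_eq_zero hL hα hA hb he h0
  have hco := coercive hα hA hb hw.memLp_deriv
  have hr : MemLp (fun x => f x - b * deriv u x) 2 (volume.restrict (Ioo 0 L)) :=
    hf.sub (hu.memLp_deriv.const_mul b)
  have hcont := h.2 _ ((memH10_iff_isH10 hL).2 hw)
  have hdisc := hs.2 _ hwm
  rw [aStab_eq hL huHF hw, loadStab_eq hL hf hw, aForm_eq hL hα hA hb huHF.isH10 hw, ← hcont,
    aForm_eq hL hα hA hb hu hw] at hdisc
  have hw2 := hw.memLp hL.le
  have hsubw := deriv_sub_ae_eq hL.le huHF.isH10.ac hvF.isH10.ac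
  have hsube := deriv_sub_ae_eq hL.le hu.ac hvF.isH10.ac
  set w := uH - v with hwdef
  set e := u - v with hedef
  set μ := volume.restrict (Ioo (0 : ℝ) L) with hμ
  have split : ∀ {p q g : ℝ → ℝ}, MemLp p 2 μ → MemLp q 2 μ → MemLp g 2 μ →
      ∫ x, (p x - q x) * g x ∂μ = (∫ x, p x * g x ∂μ) - ∫ x, q x * g x ∂μ := by
    intro p q g hp hq hg
    rw [← integral_sub (integrable_mul_fun hp hg) (integrable_mul_fun hq hg)]
    congr 1; ext x; ring
  have dU := hu.memLp_deriv
  have dV := hvF.isH10.memLp_deriv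
  have dH := huHF.isH10.memLp_deriv
  have dW := hw.memLp_deriv
  have AU := memLp_coef_mul hα hA hb dU
  have AV := memLp_coef_mul hα hA hb dV
  have AH := memLp_coef_mul hα hA hb dH
  have s1 : ∫ x, A x * deriv w x * deriv w x ∂μ =
      (∫ x, A x * deriv uH x * deriv w x ∂μ) - ∫ x, A x * deriv v x * deriv w x ∂μ := by
    rw [← split AH AV dW]
    refine integral_congr_ae ?_
    filter_upwards [hsubw] with x hx
    rw [hx]; ring
  have s2 : ∫ x, A x * deriv w x * deriv e x ∂μ =
      (∫ x, A x * deriv u x * deriv w x ∂μ) - ∫ x, A x * deriv v x * deriv w x ∂μ := by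
    rw [← split AU AV dW]
    refine integral_congr_ae ?_
    filter_upwards [hsube] with x hx
    rw [hx]; ring
  have s3 : ∀ {g : ℝ → ℝ}, MemLp g 2 μ → ∫ x, deriv w x * g x ∂μ =
      (∫ x, deriv uH x * g x ∂μ) - ∫ x, deriv v x * g x ∂μ := by
    intro g hg
    rw [← split dH dV hg]
    refine integral_congr_ae ?_
    filter_upwards [hsubw] with x hx
    rw [hx]
  have s4 : ∀ {g : ℝ → ℝ}, MemLp g 2 μ → ∫ x, deriv e x * g x ∂μ =
      (∫ x, deriv u x * g x ∂μ) - ∫ x, deriv v x * g x ∂μ := by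
    intro g hg
    rw [← split dU dV hg]
    refine integral_congr_ae ?_
    filter_upwards [hsube] with x hx
    rw [hx]
  have s5 : ∫ x, (f x - b * deriv u x) * deriv w x ∂μ =
      (∫ x, f x * deriv w x ∂μ) - b * ∫ x, deriv u x * deriv w x ∂μ := by
    rw [split hf (dU.const_mul b) dW, ← integral_const_mul]
    congr 2; ext x; ring
  have hww : ∫ x, deriv w x * deriv w x ∂μ = l2Norm 0 L (deriv w) ^ 2 := by
    rw [l2Norm_sq]; congr 1; ext x; ring
  have hw0 := hw.integral_deriv_mul_self hL.le
  have hew := IsH10.integral_deriv_mul hL.le he.ac hw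
  have a1 := s3 hw2
  have a2 := s3 dW
  have a3 := s4 hw2
  have a4 := s4 dW
  have c1 := abs_integral_mul_le (he.memLp hL.le) dW
  have c2 := abs_integral_mul_le hr dW
  have c3 := abs_integral_mul_le he.memLp_deriv dW
  have hbp : 0 < |b| := abs_pos.2 hb0
  set t := T.size / (2 * |b|) with ht
  have ht0 : 0 < t := by positivity
  have htb : T.size = 2 * |b| * t := by rw [ht]; field_simp
  set W := l2Norm 0 L (deriv w)
  set E := l2Norm 0 L (deriv e)
  set R := l2Norm 0 L (fun x => f x - b * deriv u x)
  have hW0 : 0 ≤ W := l2Norm_nonneg _ _ _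
  -- Error identity. Orthogonality of `w` and `e` allows `A v'` to be replaced by `A u'`. In the
  -- advection term the derivative is moved from `e` to `w`, so that `‖e‖` appears and Poincaré
  -- gains a factor `H`.
  have hid : (∫ x, A x * deriv w x * deriv w x ∂μ) + t * b ^ 2 * W ^ 2 =
      -b * (∫ x, e x * deriv w x ∂μ) + t * b * (∫ x, (f x - b * deriv u x) * deriv w x ∂μ) +
        t * b ^ 2 * ∫ x, deriv e x * deriv w x ∂μ := by
    rw [← hww, s1, a2, a4, s5]
    have e1 : (∫ x, A x * deriv uH x * deriv w x ∂μ) - (∫ x, A x * deriv v x * deriv w x ∂μ) =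
        (∫ x, A x * deriv uH x * deriv w x ∂μ) - ∫ x, A x * deriv u x * deriv w x ∂μ := by
      linarith
    have e2 : b * ((∫ x, deriv uH x * w x ∂μ) - ∫ x, deriv u x * w x ∂μ) =
        b * ∫ x, e x * deriv w x ∂μ := by
      congr 1; linarith
    rw [e1]
    linarith
  have hWW : 0 ≤ ∫ x, A x * deriv w x * deriv w x ∂μ := le_trans (by positivity) hco
  have b1 : -b * (∫ x, e x * deriv w x ∂μ) ≤ |b| * (T.size * E * W) := by
    refine (le_abs_self _).trans ?_
    rw [abs_mul, abs_neg]
    exact mul_le_mul_of_nonneg_left (c1.trans (mul_le_mul_of_nonneg_right hP hW0)) hbp.le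
  have b2 : t * b * (∫ x, (f x - b * deriv u x) * deriv w x ∂μ) ≤ t * |b| * (R * W) := by
    refine (le_abs_self _).trans ?_
    rw [abs_mul, abs_mul, abs_of_pos ht0]
    exact mul_le_mul_of_nonneg_left c2 (by positivity)
  have b3 : t * b ^ 2 * (∫ x, deriv e x * deriv w x ∂μ) ≤ t * |b| ^ 2 * (E * W) := by
    rw [sq_abs]
    exact mul_le_mul_of_nonneg_left ((le_abs_self _).trans c3) (by positivity)
  -- The nonnegative diffusion term is dropped. Since `T.size = 2 * |b| * t`, the advection term
  -- contributes `2 |b| E` and the stabilization `|b| E`, whence the `3`.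
  have hfin : (t * |b| * W) * (|b| * W) ≤ (t * |b| * W) * (3 * (|b| * E) + R) := by
    rw [htb] at b1
    rw [← sq_abs b] at hid b3
    linarith
  rcases hW0.eq_or_lt with h' | h'
  · rw [← h', mul_zero]
    have : 0 ≤ R := l2Norm_nonneg _ _ _
    have : 0 ≤ E := l2Norm_nonneg _ _ _
    positivity
  · exact le_of_mul_le_mul_left hfin (by positivity)

end StabMsFEM

end

/-! ### The error estimate -/

theorem mainTheorem3 :
    ∃ C : ℝ, 0 < C ∧
      ∀ (L α₁ α₂ b : ℝ) (A f u uH : ℝ → ℝ) (T : StabMsFEM.Mesh L),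
        0 < L → 0 < α₁ → α₁ ≤ α₂ → b ≠ 0 →
        AEStronglyMeasurable A (volume.restrict (Ioo 0 L)) →
        (∀ᵐ x ∂(volume.restrict (Ioo 0 L)), α₁ ≤ A x ∧ A x ≤ α₂) →
        MemLp f 2 (volume.restrict (Ioo 0 L)) →
        1 ≤ |b| * L / α₂ →
        1 ≤ |b| * T.size / (2 * α₁) →
        StabMsFEM.IsWeakSolution L A b f u →
        StabMsFEM.IsStabMsFEMSolution T A b (fun _ => T.size / (2 * |b|)) f uH →
        StabMsFEM.h1Seminorm 0 L (u - uH) ≤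
          C * T.size * (1 + Real.sqrt (α₂ ^ 2 / α₁ ^ 2 + |b| * T.size / α₁)) *
            (1 + Real.sqrt (2 * α₂ * L * |b|) / α₁) * (StabMsFEM.l2Norm 0 L f / α₁) := by
  open StabMsFEM in
  refine ⟨15, by norm_num, ?_⟩
  intro L α₁ α₂ b A f u uH T hL hα hα₂ hb0 hA hb hf hbL hbH h hs
  have hα₂0 : 0 < α₂ := hα.trans_le hα₂
  have hbp : 0 < |b| := abs_pos.2 hb0
  rw [le_div_iff₀ hα₂0, one_mul] at hbL
  rw [le_div_iff₀ (by positivity), one_mul] at hbH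
  have hH : 0 < T.size := by
    by_contra hn
    nlinarith [mul_nonneg hbp.le (neg_nonneg.2 (not_lt.1 hn))]
  have hu : IsH10 0 L u := (memH10_iff_isH10 hL).1 h.1
  obtain ⟨v, hv, hnode⟩ := exists_interpolant hL hα T hA hb hu.left hu.right
  have hvF := isFluxConst_of_mem_msSpace hL.le hα hA hb hv
  have huHF := isFluxConst_of_mem_msSpace hL.le hα hA hb hs.1
  have herr := interpolation_error hL hα hA hb hf h hvF hnode
  have hdis := discrete_error hL hα hb0 hH hA hb hf h hv hnode hs
  have hapr := h.l2Norm_deriv_le hL hα hα₂ hA hb hf hbL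
  have hres : l2Norm 0 L (fun x => f x - b * deriv u x) ≤
      l2Norm 0 L f + |b| * l2Norm 0 L (deriv u) := by
    rw [← l2Norm_const_mul]
    exact l2Norm_sub_le hf (hu.memLp_deriv.const_mul b)
  have he := hu.sub hL.le hvF.isH10
  have hw := huHF.isH10.sub hL.le hvF.isH10
  have htri : h1Seminorm 0 L (u - uH) ≤
      l2Norm 0 L (deriv (u - v)) + l2Norm 0 L (deriv (uH - v)) := by
    refine le_of_eq_of_le (l2Norm_congr ?_) (l2Norm_sub_le he.memLp_deriv hw.memLp_deriv)
    filter_upwards [weakDeriv_ae_eq_deriv hL.le (hu.sub hL.le huHF.isH10).ac,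
      deriv_sub_ae_eq hL.le hu.ac huHF.isH10.ac, deriv_sub_ae_eq hL.le hu.ac hvF.isH10.ac,
      deriv_sub_ae_eq hL.le huHF.isH10.ac hvF.isH10.ac] with x h1 h2 h3 h4
    rw [h1, h2, h3, h4]; ring
  set F := l2Norm 0 L f
  set S := Real.sqrt (2 * α₂ * L * |b|) / α₁
  set Q := Real.sqrt (α₂ ^ 2 / α₁ ^ 2 + |b| * T.size / α₁)
  set R := l2Norm 0 L (fun x => f x - b * deriv u x)
  set E := l2Norm 0 L (deriv (u - v))
  set W := l2Norm 0 L (deriv (uH - v))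
  have hF0 : 0 ≤ F := l2Norm_nonneg _ _ _
  have hR0 : 0 ≤ R := l2Norm_nonneg _ _ _
  have hS0 : 0 ≤ S := by positivity
  have hQ0 : 0 ≤ Q := Real.sqrt_nonneg _
  have hR : R ≤ 3 * ((1 + S) * F) := by linarith
  have hE : E ≤ T.size * R / α₁ := by rw [le_div_iff₀ hα]; linarith
  -- The condition `|b| H ≥ 2 α₁` makes the consistency term `R / |b|` no larger than half of `H R /
  -- α₁`.
  have hRb : R ≤ |b| * (T.size * R / α₁) / 2 := by
    have : |b| * (T.size * R / α₁) / 2 = |b| * T.size / (2 * α₁) * R := by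
      field_simp
    rw [this]
    exact le_mul_of_one_le_left hR0 (by rw [le_div_iff₀ (by positivity), one_mul]; exact hbH)
  have hW : W ≤ 3 * E + T.size * R / α₁ / 2 := by
    refine le_of_mul_le_mul_left ?_ hbp
    linarith
  -- With `X = H R / α₁`, `E + W ≤ 4 E + X / 2 ≤ 5 X`; the bound on `R` supplies another `3`, hence
  -- `C = 15`.
  have hfin : 5 * (T.size * R / α₁) ≤ 15 * T.size * (1 + S) * (F / α₁) := by
    have h1 : T.size * R / α₁ ≤ T.size * (3 * ((1 + S) * F)) / α₁ := by gcongr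
    have h2 : 5 * (T.size * (3 * ((1 + S) * F)) / α₁) = 15 * T.size * (1 + S) * (F / α₁) := by
      ring
    linarith
  have hX : 0 ≤ T.size * R / α₁ := by positivity
  have hY : 0 ≤ 15 * T.size * (1 + S) * (F / α₁) := by positivity
  calc h1Seminorm 0 L (u - uH) ≤ 15 * T.size * (1 + S) * (F / α₁) := by linarith
    _ ≤ (1 + Q) * (15 * T.size * (1 + S) * (F / α₁)) :=
        le_mul_of_one_le_left hY (by linarith)
    _ = _ := by ring
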